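/- Let $\mathcal A$ and $\mathcal B$ be abelian categories, and let $\Phi:\mathcal A\to\mathcal B$, $\Psi:\mathcal B\to\mathcal A$ be a right adjoint pair of (additive) contravariant functors, i.e. $\operatorname{Hom}_{\mathcal A}(X,\Psi Y)\cong\operatorname{Hom}_{\mathcal B}(Y,\Phi X)$ naturally, with unit $\eta_X:X\to\Psi\Phi X$. Let $\mathcal K^*(\mathcal A)$ and $\mathcal K^\dagger(\mathcal B)$ each be the homotopy category of all, of the bounded below, of the bounded above, or of the bounded cochain complexes (the two choices being independent), with derived categories $\mathcal D^*(\mathcal A)$ and $\mathcal D^\dagger(\mathcal B)$. Assume that there is a triangulated subcategory $\mathcal P\subseteq\mathcal K^*(\mathcal A)$ such that every $X\in\mathcal K^*(\mathcal A)$ admits a quasi-isomorphism $P\to X$ with $P\in\mathcal P$ (a quasi-isomorphism from $X$ into $P$ in the opposite category), and such that $\Phi(P)$ is exact for every exact complex $P\in\mathcal P$; assume likewise that there is such a subcategory $\mathcal Q\subseteq\mathcal K^\dagger(\mathcal B)$ for $\Psi$. Then the right derived functors $\mathbf R^*\Phi:\mathcal D^*(\mathcal A)\to\mathcal D(\mathcal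 B)$ and $\mathbf R^\dagger\Psi:\mathcal D^\dagger(\mathcal B)\to\mathcal D(\mathcal A)$ exist. Call $X\in\mathcal A$ $\Phi$-acyclic if $H^i(\mathbf R^*\Phi X)=0$ for all $i\neq0$, and define $\Psi$-acyclic objects of $\mathcal B$ in the same way. Let $\mathcal G_{\Phi\Psi}$ be the class of all $X\in\mathcal A$ such that $X$ is $\Phi$-acyclic, $\Phi X$ is $\Psi$-acyclic, and $\eta_X$ is an isomorphism. For a class $\mathcal F$ of objects of $\mathcal A$, the $\mathcal F$-dimension of $M$ is the least $\alpha\in\mathbb N\cup\{\infty\}$ for which there is an exact sequence $\cdots\to F_1\to F_0\to M\to0$ with all $F_i\in\mathcal F\cup\{0\}$ and $F_i=0$ for $i>\alpha$. The projective dimension $\operatorname{pd}M$ is the $\mathcal F$-dimension for the class $\mathcal F$ of projective objects; in particular $\operatorname{pd}0=0$. Let $A\in\mathcal A$ be an object of finite $\mathcal G_{\Phi\Psi}$-dimension. Then: (a) $\mathcal G_{\Phi\Psi}\text{-}\dim A=\sup\{i\in\mathbb Z: H^i(\mathbf R^*\Phi A)\neq0\}$. For $A\ne0$ this is the supremum of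 a nonempty set of integers which is bounded above; for $A=0$ the set is empty, the dimension is $0$, and the supremum is read as $0$. (b) If the category $\mathcal A$ has enough projectives, then $\mathcal G_{\Phi\Psi}\text{-}\dim A\le\operatorname{pd}A$. -/

import Mathlib

open CategoryTheory Category Limits Opposite Pretriangulated

universe w w' v v' u u'

/-- The four types of complexes: arbitrary, bounded below, bounded above, bounded. They index the
homotopy categories `K(C)`, `K⁺(C)`, `K⁻(C)`, `Kᵇ(C)` and the derived categories. -/
inductive Boundedness
  | unbounded
  | below
  | above
  | bounded

namespace Boundedness

/-- The property of cochain complexes which is indicated by a boundedness type. -/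
def cochain (C : Type u) [Category.{v} C] [HasZeroMorphisms C] :
    Boundedness → ObjectProperty (CochainComplex C ℤ)
  | unbounded => fun _ => True
  | below => fun K => ∃ m : ℤ, K.IsStrictlyGE m
  | above => fun K => ∃ n : ℤ, K.IsStrictlyLE n
  | bounded => fun K => (∃ m : ℤ, K.IsStrictlyGE m) ∧ ∃ n : ℤ, K.IsStrictlyLE n

variable (C : Type u) [Category.{v} C] [Abelian C] (b : Boundedness)

/-- The complexes of the given boundedness type, as objects of the homotopy category. -/
def homotopy : ObjectProperty (HomotopyCategory C (.up ℤ)) :=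
  fun K => b.cochain C K.as

variable {C} in
lemma cochain_shift (K : CochainComplex C ℤ) (hK : b.cochain C K) (n : ℤ) :
    b.cochain C (K⟦n⟧) := by
  have h₁ (h : ∃ m : ℤ, K.IsStrictlyGE m) : ∃ m : ℤ, (K⟦n⟧).IsStrictlyGE m := by
    obtain ⟨m, _⟩ := h
    exact ⟨m - n, K.isStrictlyGE_shift m n (m - n) (by lia)⟩
  have h₂ (h : ∃ m : ℤ, K.IsStrictlyLE m) : ∃ m : ℤ, (K⟦n⟧).IsStrictlyLE m := by
    obtain ⟨m, _⟩ := h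
    exact ⟨m - n, K.isStrictlyLE_shift m n (m - n) (by lia)⟩
  cases b
  · trivial
  · exact h₁ hK
  · exact h₂ hK
  · exact ⟨h₁ hK.1, h₂ hK.2⟩

variable {C} in
lemma cochain_cone {K L : CochainComplex C ℤ} (f : K ⟶ L) (hK : b.cochain C K)
    (hL : b.cochain C L) : b.cochain C (CochainComplex.mappingCone f) := by
  have h₁ (hK : ∃ m : ℤ, K.IsStrictlyGE m) (hL : ∃ m : ℤ, L.IsStrictlyGE m) :
      ∃ m : ℤ, (CochainComplex.mappingCone f).IsStrictlyGE m := by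
    obtain ⟨m, _⟩ := hK
    obtain ⟨n, _⟩ := hL
    exact ⟨min (m - 1) n, CochainComplex.isStrictlyGE_mappingCone f m n _ (by simp) (by simp)⟩
  have h₂ (hK : ∃ m : ℤ, K.IsStrictlyLE m) (hL : ∃ m : ℤ, L.IsStrictlyLE m) :
      ∃ m : ℤ, (CochainComplex.mappingCone f).IsStrictlyLE m := by
    obtain ⟨m, _⟩ := hK
    obtain ⟨n, _⟩ := hL
    refine ⟨max m n, ?_⟩
    rw [CochainComplex.isStrictlyLE_iff]
    intro i hi
    rw [CochainComplex.mappingCone.isZero_X_iff]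
    exact ⟨K.isZero_of_isStrictlyLE m _ (by grind), L.isZero_of_isStrictlyLE n _ (by grind)⟩
  cases b
  · trivial
  · exact h₁ hK hL
  · exact h₂ hK hL
  · exact ⟨h₁ hK.1 hL.1, h₂ hK.2 hL.2⟩

variable {C} in
lemma cochain_single (X : C) (n : ℤ) :
    b.cochain C ((CochainComplex.singleFunctor C n).obj X) := by
  cases b
  · trivial
  · exact ⟨n, inferInstance⟩
  · exact ⟨n, inferInstance⟩
  · exact ⟨⟨n, inferInstance⟩, ⟨n, inferInstance⟩⟩

instance : (b.homotopy C).IsTriangulatedClosed₃ where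
  ext₃' T hT h₁ h₂ := by
    obtain ⟨f : T.obj₁.as ⟶ T.obj₂.as, hf⟩ :=
      (HomotopyCategory.quotient C (.up ℤ)).map_surjective T.mor₁
    exact ⟨(HomotopyCategory.quotient C (.up ℤ)).obj (CochainComplex.mappingCone f),
      b.cochain_cone f h₁ h₂,
      ⟨Triangle.π₃.mapIso (isoTriangleOfIso₁₂ T _ hT
        (HomotopyCategory.mappingCone_triangleh_distinguished f)
        (Iso.refl _) (Iso.refl _) ((comp_id _).trans (hf.symm.trans (id_comp _).symm)))⟩⟩

instance : (b.homotopy C).IsStableUnderShift ℤ where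
  isStableUnderShiftBy n :=
    { le_shift := fun K hK => by
        obtain ⟨K : CochainComplex _ _, rfl⟩ := K.quotient_obj_surjective
        rw [ObjectProperty.prop_shift_iff, HomotopyCategory.shift_quotient_obj]
        exact b.cochain_shift K hK n }

open ZeroObject in
instance : (b.homotopy C).IsTriangulated where
  exists_zero :=
    ⟨(HomotopyCategory.quotient C (.up ℤ)).obj ((CochainComplex.singleFunctor C 0).obj 0),
      Functor.map_isZero _ (Functor.map_isZero _ (isZero_zero _)), b.cochain_single 0 0⟩
  toIsTriangulatedClosed₂ := .of_isTriangulatedClosed₃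

/-- The homotopy category `K^*(C)` of complexes of the given boundedness type; it is a full
triangulated subcategory of `K(C)`. -/
abbrev K := (b.homotopy C).FullSubcategory

/-- The exact complexes in `K^*(C)`. -/
abbrev acyclic : ObjectProperty (b.K C) :=
  (HomotopyCategory.subcategoryAcyclic C).inverseImage (b.homotopy C).ι

/-- The quasi-isomorphisms in `K^*(C)`. -/
def quasiIso : MorphismProperty (b.K C) :=
  (HomotopyCategory.quasiIso C (.up ℤ)).inverseImage (b.homotopy C).ι

lemma quasiIso_eq_trW : b.quasiIso C = (b.acyclic C).trW := by
  ext X Y f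
  rw [ObjectProperty.inverseImage_trW_iff, ← HomotopyCategory.quasiIso_eq_trW_subcategoryAcyclic]
  rfl

/-- The derived category `D^*(C)`: the localization of `K^*(C)` at the quasi-isomorphisms. -/
abbrev D := (b.quasiIso C).Localization

variable {C} in
/-- The object `X`, seen as a complex concentrated in degree `0`, in `K^*(C)`. -/
noncomputable def stalk (X : C) : b.K C :=
  ⟨(HomotopyCategory.quotient C (.up ℤ)).obj ((CochainComplex.singleFunctor C 0).obj X),
    b.cochain_single X 0⟩

end Boundedness

namespace ContravariantDerived

section Contravariant

variable {A : Type u} [Category.{v} A] [Abelian A] {B : Type u'} [Category.{v'} B] [Abelian B]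
  (Φ : Aᵒᵖ ⥤ B) [Φ.Additive]

/-- A contravariant functor `Φ`, applied termwise to cochain complexes: the complex `Φ(K)` has
`Φ(K)ⁱ = Φ(K⁻ⁱ)`, and its differentials are the images of the differentials of `K`. -/
noncomputable def contraComplex : (CochainComplex A ℤ)ᵒᵖ ⥤ CochainComplex B ℤ :=
  (CochainComplex.opEquivalence A).functor ⋙ Φ.mapHomologicalComplex (.up ℤ)

lemma contraComplex_X (K : CochainComplex A ℤ) (i : ℤ) :
    ((contraComplex Φ).obj (op K)).X i = Φ.obj (op (K.X (-i))) := rfl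

lemma contraComplex_d (K : CochainComplex A ℤ) (i j : ℤ) :
    ((contraComplex Φ).obj (op K)).d i j = Φ.map (K.d (-j) (-i)).op := rfl

/-- The contravariant functor `K(A) → K(B)` induced by `Φ`. -/
noncomputable def contraHomotopy :
    (HomotopyCategory A (.up ℤ))ᵒᵖ ⥤ HomotopyCategory B (.up ℤ) :=
  Functor.leftOp (CategoryTheory.Quotient.lift _
    (contraComplex Φ ⋙ HomotopyCategory.quotient B (.up ℤ)).rightOp
    (by
      rintro K L f g ⟨h⟩
      exact congrArg Quiver.Hom.op (HomotopyCategory.eq_of_homotopy _ _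
        (Φ.mapHomotopy (CochainComplex.homotopyOp h)))))

lemma contraHomotopy_obj (K : CochainComplex A ℤ) :
    (contraHomotopy Φ).obj (op ((HomotopyCategory.quotient A (.up ℤ)).obj K)) =
      (HomotopyCategory.quotient B (.up ℤ)).obj ((contraComplex Φ).obj (op K)) := rfl

end Contravariant

section Derivability

variable {T : Type*} [Category* T] [HasZeroObject T] [HasShift T ℤ]
  [Preadditive T] [∀ n : ℤ, (shiftFunctor T n).Additive] [Pretriangulated T] [IsTriangulated T]
  (P N : ObjectProperty T) [P.IsTriangulated] [N.IsTriangulated] [N.IsClosedUnderIsomorphisms]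

lemma isLeftDerivabilityStructure_of_resolutions
    (h : ∀ X : T, ∃ (L : T) (f : L ⟶ X), P L ∧ N.trW f) :
    (P.triangulatedLocalizerMorphism N).IsLeftDerivabilityStructure := by
  have : P.IsVerdierLeftLocalizing N := by
    rw [ObjectProperty.isVerdierLeftLocalizing_iff]
    intro X Y s hY hs
    obtain ⟨Z, a, hZ, ha⟩ := h X
    refine ⟨Z, a ≫ s, a, hZ, ?_, rfl⟩
    have hs' := N.trW.comp_mem _ _ ha hs
    obtain ⟨U, hU, g, k, hT⟩ := P.distinguished_cocone_triangle (a ≫ s) hZ hY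
    exact ⟨U, g, k, hT, hU, (N.trW_iff_of_distinguished _ hT).1 hs'⟩
  have hres : (P.triangulatedLocalizerMorphism N).HasLeftResolutions := fun X => by
    obtain ⟨L, f, hL, hf⟩ := h X
    exact ⟨{ X₁ := ⟨L, hL⟩, w := f, hw := hf }⟩
  have : (P.triangulatedLocalizerMorphism N).IsLocalizedEquivalence := by
    let F := (P.triangulatedLocalizerMorphism N).localizedFunctor
      (N.inverseImage P.ι).trW.Q N.trW.Q
    have : F.EssSurj := by
      have := (P.triangulatedLocalizerMorphism N).essSurj_of_hasLeftResolutions N.trW.Q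
      have e := CatCommSq.iso (P.triangulatedLocalizerMorphism N).functor
        (N.inverseImage P.ι).trW.Q N.trW.Q F
      have : ((N.inverseImage P.ι).trW.Q ⋙ F).EssSurj := Functor.essSurj_of_iso e
      exact ⟨fun Y => ⟨_, ⟨((N.inverseImage P.ι).trW.Q ⋙ F).objObjPreimageIso Y⟩⟩⟩
    exact { isEquivalence := { } }
  have : (P.triangulatedLocalizerMorphism N).arrow.HasLeftResolutions := fun f => by
    obtain ⟨L, s, hL, hs⟩ := h f.right
    obtain ⟨φ, hφ⟩ := MorphismProperty.HasRightCalculusOfFractions.exists_rightFraction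
      (W := N.trW) (MorphismProperty.LeftFraction.mk f.hom s hs)
    obtain ⟨M, t, hM, ht⟩ := h φ.X'
    dsimp at φ hφ
    exact ⟨{ X₁ := Arrow.mk (P.homMk (t ≫ φ.f) : (⟨M, hM⟩ : P.FullSubcategory) ⟶ ⟨L, hL⟩)
             w := Arrow.homMk (t ≫ φ.s) s (by
               change (t ≫ φ.s) ≫ f.hom = (t ≫ φ.f) ≫ s
               simp [hφ])
             hw := ⟨N.trW.comp_mem _ _ ht φ.hs, hs⟩ }⟩
  have (X : T) : IsConnected ((P.triangulatedLocalizerMorphism N).LeftResolution X) := by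
    have : Nonempty ((P.triangulatedLocalizerMorphism N).LeftResolution X) := hres X
    refine zigzag_isConnected (fun R₁ R₂ => ?_)
    obtain ⟨φ, hφ⟩ := MorphismProperty.HasRightCalculusOfFractions.exists_rightFraction
      (W := N.trW) (MorphismProperty.LeftFraction.mk R₁.w R₂.w R₂.hw)
    obtain ⟨M, t, hM, ht⟩ := h φ.X'
    dsimp at φ hφ
    let R : (P.triangulatedLocalizerMorphism N).LeftResolution X :=
      { X₁ := ⟨M, hM⟩
        w := t ≫ φ.s ≫ R₁.w
        hw := N.trW.comp_mem _ _ ht (N.trW.comp_mem _ _ φ.hs R₁.hw) }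
    let g₁ : R ⟶ R₁ :=
      { f := P.homMk (t ≫ φ.s)
        comm := by simp [R, ObjectProperty.triangulatedLocalizerMorphism] }
    let g₂ : R ⟶ R₂ :=
      { f := P.homMk (t ≫ φ.f)
        comm := by simp [R, hφ, ObjectProperty.triangulatedLocalizerMorphism] }
    exact Zigzag.trans (Zigzag.of_inv g₁) (Zigzag.of_hom g₂)
  exact LocalizerMorphism.IsLeftDerivabilityStructure.mk' _

end Derivability

section Transfer

lemma quasiIso_restrictionMap {ι ι' : Type*} {c : ComplexShape ι} {c' : ComplexShape ι'}
    {C : Type*} [Category* C] [Abelian C] {K L : HomologicalComplex C c'} (e : c.Embedding c')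
    [e.IsRelIff] (f : K ⟶ L) (hf : QuasiIso f) (hp : ∀ j, c'.prev (e.f j) = e.f (c.prev j))
    (hn : ∀ j, c'.next (e.f j) = e.f (c.next j)) :
    QuasiIso (HomologicalComplex.restrictionMap f e) := by
  rw [quasiIso_iff]
  intro j
  rw [quasiIsoAt_iff_isIso_homologyMap]
  have : HomologicalComplex.homologyMap (HomologicalComplex.restrictionMap f e) j =
    (K.restrictionHomologyIso e _ j _ rfl rfl rfl rfl rfl (hp j) (hn j)).hom ≫
      HomologicalComplex.homologyMap f (e.f j) ≫
    (L.restrictionHomologyIso e _ j _ rfl rfl rfl rfl rfl (hp j) (hn j)).inv := by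
    rw [← cancel_epi (HomologicalComplex.homologyπ _ _),
      ← cancel_mono (HomologicalComplex.homologyι _ _)]
    simp
    change _ = _ ≫ 𝟙 (K.X (e.f j)) ≫ f.f (e.f j) ≫ 𝟙 (L.X (e.f j)) ≫ _
    erw [id_comp, id_comp]
    rfl
  rw [this]
  infer_instance

variable {A : Type u} [Category.{v} A] [Abelian A] {B : Type u'} [Category.{v'} B] [Abelian B]
  (Φ : Aᵒᵖ ⥤ B) [Φ.Additive]

lemma quasiIso_contraComplex_map {K L : CochainComplex A ℤ} (f : K ⟶ L)
    (hf : QuasiIso ((Φ.rightOp.mapHomologicalComplex (.up ℤ)).map f)) :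
    QuasiIso ((contraComplex Φ).map f.op) := by
  let g := (HomologicalComplex.unopFunctor B (.up ℤ)).map
    ((Φ.rightOp.mapHomologicalComplex (.up ℤ)).map f).op
  have hg : QuasiIso g := (HomologicalComplex.quasiIso_unopFunctor_map_iff
    ((Φ.rightOp.mapHomologicalComplex (.up ℤ)).map f)).2 hf
  exact quasiIso_restrictionMap (c' := ComplexShape.down ℤ) ComplexShape.embeddingUpIntDownInt g hg
    (fun j => by simp; lia) (fun j => by simp; lia)

lemma acyclic_of_contraComplex (K : CochainComplex A ℤ)
    (h : ((contraComplex Φ).obj (op K)).Acyclic) :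
    ((Φ.rightOp.mapHomologicalComplex (.up ℤ)).obj K).Acyclic := by
  let M : ChainComplex B ℤ := ((Φ.rightOp.mapHomologicalComplex (.up ℤ)).obj K).unop
  refine HomologicalComplex.Acyclic.op (K := M) (fun n => ?_)
  have hn := h (-n)
  rw [HomologicalComplex.exactAt_iff_isZero_homology] at hn ⊢
  exact hn.of_iso (HomologicalComplex.restrictionHomologyIso M ComplexShape.embeddingUpIntDownInt
    (-n-1) (-n) (-n+1) (by simp) (by simp) (i' := n + 1) (j' := n) (k' := n - 1)
    (by simp; lia) (by simp) (by simp; lia) (by simp) (by simp)).symm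

end Transfer

section RightDerived

variable {A : Type u} [Category.{v} A] [Abelian A] {B : Type u'} [Category.{v'} B] [Abelian B]
  (Φ : Aᵒᵖ ⥤ B) [Φ.Additive] (b : Boundedness)

/-- A triangulated subcategory `P` of `K^*(A)` which allows to derive the contravariant functor
`Φ` on the right: every complex `X` in `K^*(A)` has a resolution `L ⟶ X`, that is, a
quasi-isomorphism (which becomes a morphism from `X` into `L` in the opposite category) with `L`
in `P`, and `Φ` preserves the exactness of the complexes in `P`. -/
structure IsAdapted (P : ObjectProperty (b.K A)) : Prop where
  isTriangulated : P.IsTriangulated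
  exists_resolution (X : b.K A) : ∃ (L : b.K A) (f : L ⟶ X), P L ∧ b.quasiIso A f
  acyclic_map (L : b.K A) (_ : P L) (_ : b.acyclic A L) :
    HomotopyCategory.subcategoryAcyclic B ((contraHomotopy Φ).obj (op L.obj))

/-- The existence of a triangulated subcategory of `K^*(A)` adapted to `Φ`. -/
def HasAdapted : Prop := ∃ P : ObjectProperty (b.K A), IsAdapted Φ b P

variable {Φ b} in
lemma IsAdapted.isLeftDerivabilityStructure {P : ObjectProperty (b.K A)}
    [P.IsTriangulated] (h : IsAdapted Φ b P) :
    (P.triangulatedLocalizerMorphism (b.acyclic A)).IsLeftDerivabilityStructure := by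
  refine isLeftDerivabilityStructure_of_resolutions P (b.acyclic A) (fun X => ?_)
  rw [← b.quasiIso_eq_trW A]
  exact h.exists_resolution X

variable [HasDerivedCategory.{w} B]

/-- The contravariant functor `K^*(A) → K(B) → D(B)` induced by `Φ`. -/
noncomputable def toDerived : (b.K A)ᵒᵖ ⥤ DerivedCategory B :=
  (b.homotopy A).ι.op ⋙ contraHomotopy Φ ⋙ DerivedCategory.Qh

variable {Φ b}

lemma IsAdapted.derives {P : ObjectProperty (b.K A)} [P.IsTriangulated] (h : IsAdapted Φ b P) :
    (P.triangulatedLocalizerMorphism (b.acyclic A)).op.Derives (toDerived Φ b) := by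
  rintro X Y f hf
  obtain ⟨Z, g, k, hT, hZ⟩ := hf
  let F := Φ.rightOp.mapHomotopyCategory (.up ℤ)
  let G := P.ι ⋙ (b.homotopy A).ι ⋙ F
  have hT' := G.map_distinguished _ hT
  have hZ' : HomotopyCategory.subcategoryAcyclic Bᵒᵖ (G.obj Z) := by
    have h₁ := h.acyclic_map Z.obj Z.property hZ
    obtain ⟨M, hM⟩ := HomotopyCategory.quotient_obj_surjective Z.obj.obj
    change HomotopyCategory.subcategoryAcyclic Bᵒᵖ (F.obj Z.obj.obj)
    rw [← hM] at h₁ ⊢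
    exact (HomotopyCategory.quotient_obj_mem_subcategoryAcyclic_iff_acyclic _).2
      (acyclic_of_contraComplex Φ M
        ((HomotopyCategory.quotient_obj_mem_subcategoryAcyclic_iff_acyclic _).1 h₁))
  have hq : HomotopyCategory.quasiIso Bᵒᵖ (.up ℤ) (G.map f.unop) := by
    rw [HomotopyCategory.quasiIso_eq_trW_subcategoryAcyclic]
    exact ⟨_, _, _, hT', hZ'⟩
  obtain ⟨φ, hφ⟩ := (HomotopyCategory.quotient A (.up ℤ)).map_surjective f.unop.hom.hom
  have hq' : HomotopyCategory.quasiIso B (.up ℤ) ((contraHomotopy Φ).map f.unop.hom.hom.op) := by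
    change HomotopyCategory.quasiIso Bᵒᵖ (.up ℤ) (F.map f.unop.hom.hom) at hq
    rw [← hφ] at hq ⊢
    exact (HomotopyCategory.quotient_map_mem_quasiIso_iff ((contraComplex Φ).map φ.op)).2
      (quasiIso_contraComplex_map Φ φ ((HomotopyCategory.quotient_map_mem_quasiIso_iff
        ((Φ.rightOp.mapHomologicalComplex (.up ℤ)).map φ)).1 hq))
  exact Localization.inverts DerivedCategory.Qh (HomotopyCategory.quasiIso B (.up ℤ)) _ hq'

lemma HasAdapted.hasRightDerivedFunctor (h : HasAdapted Φ b) :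
    (toDerived Φ b).HasRightDerivedFunctor (b.quasiIso A).op := by
  obtain ⟨P, hP⟩ := h
  have := hP.isTriangulated
  have := hP.isLeftDerivabilityStructure
  have : (toDerived Φ b).HasPointwiseRightDerivedFunctor (b.quasiIso A).op := by
    rw [b.quasiIso_eq_trW A]
    exact hP.derives.hasPointwiseRightDerivedFunctor
  infer_instance

/-- The total right derived functor `R^*Φ : D^*(A)ᵒᵖ ⥤ D(B)` of the contravariant functor `Φ`. -/
noncomputable def totalDerived (h : HasAdapted Φ b) : (b.D A)ᵒᵖ ⥤ DerivedCategory B :=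
  have := h.hasRightDerivedFunctor
  (toDerived Φ b).totalRightDerived (b.quasiIso A).Q.op (b.quasiIso A).op

/-- The canonical natural transformation from `Φ` to `R^*Φ`. -/
noncomputable def totalDerivedUnit (h : HasAdapted Φ b) :
    toDerived Φ b ⟶ (b.quasiIso A).Q.op ⋙ totalDerived h :=
  have := h.hasRightDerivedFunctor
  (toDerived Φ b).totalRightDerivedUnit (b.quasiIso A).Q.op (b.quasiIso A).op

/-- The universal property of `R^*Φ`. -/
lemma isRightDerivedFunctor_totalDerived (h : HasAdapted Φ b) :
    (totalDerived h).IsRightDerivedFunctor (totalDerivedUnit h) (b.quasiIso A).op := by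
  have := h.hasRightDerivedFunctor
  dsimp only [totalDerived, totalDerivedUnit]
  infer_instance

/-- `R^*Φ` is computed by `Φ` on the complexes of an adapted subcategory. -/
lemma isIso_totalDerivedUnit_app (h : HasAdapted Φ b) {P : ObjectProperty (b.K A)}
    (hP : IsAdapted Φ b P) (L : b.K A) (hL : P L) :
    IsIso ((totalDerivedUnit h).app (op L)) := by
  have := hP.isTriangulated
  have := hP.isLeftDerivabilityStructure
  have h₁ := isRightDerivedFunctor_totalDerived h
  have h₂ : (b.quasiIso A).Q.op.IsLocalization (b.acyclic A).trW.op := by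
    rw [← b.quasiIso_eq_trW A]
    infer_instance
  have h₃ : (totalDerived h).IsRightDerivedFunctor (totalDerivedUnit h) (b.acyclic A).trW.op :=
    (Functor.isRightDerivedFunctor_iff_isLeftKanExtension _ _ _).2
      ((Functor.isRightDerivedFunctor_iff_isLeftKanExtension _ _ _).1 h₁)
  exact hP.derives.isIso_of_isRightDerivedFunctor (totalDerivedUnit h)
    (op (⟨L, hL⟩ : P.FullSubcategory))

/-- `Hⁱ(R^*Φ X)`, for an object `X` of `A`. -/
noncomputable def cohomology (h : HasAdapted Φ b) (X : A) (i : ℤ) : B :=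
  (DerivedCategory.homologyFunctor B i).obj
    ((totalDerived h).obj (op ((b.quasiIso A).Q.obj (b.stalk X))))

/-- `X` is `Φ`-acyclic: `Hⁱ(R^*Φ X) = 0` for all `i ≠ 0`. -/
def IsAcyclicFor (h : HasAdapted Φ b) (X : A) : Prop :=
  ∀ i : ℤ, i ≠ 0 → IsZero (cohomology h X i)

end RightDerived

/-- The class `𝒢_{ΦΨ}` attached to a right adjoint pair `(Φ, Ψ)` of contravariant functors, with
unit `η_X : X ⟶ ΨΦ(X)`. -/
def gorensteinClass {A : Type u} [Category.{v} A] [Abelian A]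
    {B : Type u'} [Category.{v'} B] [Abelian B]
    [HasDerivedCategory.{w} A] [HasDerivedCategory.{w'} B]
    {Φ : Aᵒᵖ ⥤ B} {Ψ : Bᵒᵖ ⥤ A} [Φ.Additive] [Ψ.Additive] (adj : Φ.rightOp ⊣ Ψ)
    {s t : Boundedness} (hΦ : HasAdapted Φ s) (hΨ : HasAdapted Ψ t) : ObjectProperty A :=
  fun X => IsAcyclicFor hΦ X ∧ IsAcyclicFor hΨ (Φ.obj (op X)) ∧ IsIso (adj.unit.app X)

section Dimension

variable {A : Type u} [Category.{v} A] [Abelian A] (F : ObjectProperty A)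

/-- `M` has left `F`-dimension `≤ α`: there is an exact sequence `⋯ ⟶ F₁ ⟶ F₀ ⟶ M ⟶ 0` with all
`Fᵢ` in `F ∪ {0}`, and `Fᵢ = 0` for `i > α`. -/
def HasLeftDimLE (M : A) (α : ℕ∞) : Prop :=
  ∃ (K : ChainComplex A ℕ) (ε : K.X 0 ⟶ M) (w : K.d 1 0 ≫ ε = 0),
    Epi ε ∧ (ShortComplex.mk (K.d 1 0) ε w).Exact ∧ (∀ n : ℕ, K.ExactAt (n + 1)) ∧
    (∀ i : ℕ, F (K.X i) ∨ IsZero (K.X i)) ∧ ∀ i : ℕ, α < (i : ℕ∞) → IsZero (K.X i)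

/-- The left `F`-dimension: the least `α` such that the `F`-dimension is `≤ α` (and `∞` for the
objects without any `F`-resolution). -/
noncomputable def leftDim (M : A) : ℕ∞ := sInf {α : ℕ∞ | HasLeftDimLE F M α}

variable (A) in
/-- The projective dimension is the left dimension with respect to the projective objects. -/
noncomputable def projDim (M : A) : ℕ∞ := leftDim (isProjective A) M

end Dimension

end ContravariantDerived

open ContravariantDerived

/-! The adjunction makes both contravariant functors left exact, so `Hⁱ(RΦ X)` behaves like a
sequence of Ext groups: it vanishes for `i < 0`, equals `Φ X` for `i = 0`, and has long exact
sequences. Cutting a resolution by Φ-acyclic objects into short exact sequences gives vanishing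
above its length.

The converse rests on `gorensteinClass_X₃`: if two objects of `𝒢` have a Φ-acyclic quotient, then
applying `Φ` and then `Ψ` keeps the sequence exact, and comparing it with its double dual puts the
quotient in `𝒢`. Hence a Φ-acyclic object of finite `𝒢`-dimension lies in `𝒢`, and passing to
syzygies gives `𝒢`-dimension at most `n` once the cohomology vanishes above `n`. The bound is
attained: for positive dimension by minimality, and for dimension `0` because `Φ X = 0` would force
`X ≅ ΨΦX = 0`.

Projectives are Φ-acyclic, so the cohomology vanishes above the projective dimension, which gives
(b).

The delicate point is that adapted complexes may be unbounded. A resolution `L` in `P` is therefore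
compared with a truncation `K ⟶ L` that need not lie in `P`; `mono_contraHomology_map` says that
`Hⁱ(ΦL)` still embeds in `Hⁱ(ΦK)`. -/

namespace ContravariantDerived

/-! ### Long exact sequences of contravariant cohomology. -/

section LongExact

variable {C : Type*} [Category* C] {C' : Type*} [Category* C'] {B : Type*} [Category* B] [Abelian B]

/-- Two consecutive degrees `R₀`, `R₁` of a contravariant cohomological functor fit in a long exact
sequence for the morphisms `X ⟶ Y ⟶ Z`. -/
def IsLongExact (R₀ R₁ : Cᵒᵖ ⥤ B) {X Y Z : C} (f : X ⟶ Y) (g : Y ⟶ Z) : Prop :=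
  ∃ δ : R₀.obj (op X) ⟶ R₁.obj (op Z),
    (ComposableArrows.mk₅ (R₀.map g.op) (R₀.map f.op) δ (R₁.map g.op) (R₁.map f.op)).Exact

namespace IsLongExact

variable {R₀ R₁ : Cᵒᵖ ⥤ B} {X Y Z : C} {f : X ⟶ Y} {g : Y ⟶ Z}

/-- The connecting map is only asserted to exist, so it can be conjugated by the given isomorphisms;
no compatibility with a prescribed `δ`, and no sign, has to be checked. -/
lemma of_iso {R₀' R₁' : C'ᵒᵖ ⥤ B} {X' Y' Z' : C'}
    {f' : X' ⟶ Y'} {g' : Y' ⟶ Z'} (h : IsLongExact R₀ R₁ f g)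
    (aX : R₀.obj (op X) ≅ R₀'.obj (op X')) (aY : R₀.obj (op Y) ≅ R₀'.obj (op Y'))
    (aZ : R₀.obj (op Z) ≅ R₀'.obj (op Z')) (bX : R₁.obj (op X) ≅ R₁'.obj (op X'))
    (bY : R₁.obj (op Y) ≅ R₁'.obj (op Y')) (bZ : R₁.obj (op Z) ≅ R₁'.obj (op Z'))
    (haf : R₀.map f.op ≫ aX.hom = aY.hom ≫ R₀'.map f'.op)
    (hag : R₀.map g.op ≫ aY.hom = aZ.hom ≫ R₀'.map g'.op)
    (hbf : R₁.map f.op ≫ bX.hom = bY.hom ≫ R₁'.map f'.op)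
    (hbg : R₁.map g.op ≫ bY.hom = bZ.hom ≫ R₁'.map g'.op) :
    IsLongExact R₀' R₁' f' g' := by
  obtain ⟨δ, hδ⟩ := h
  refine ⟨aX.inv ≫ δ ≫ bZ.hom, ?_⟩
  exact ComposableArrows.exact_of_iso
    (ComposableArrows.isoMk₅ aZ aY aX bZ bY bX hag haf
      (show δ ≫ bZ.hom = aX.hom ≫ aX.inv ≫ δ ≫ bZ.hom by simp) hbg hbf) hδ

lemma epi (h : IsLongExact R₀ R₁ f g) (hZ : IsZero (R₁.obj (op Z))) : Epi (R₀.map f.op) := by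
  obtain ⟨δ, hδ⟩ := h
  exact (hδ.exact 1).epi_f (hZ.eq_of_tgt _ _)

lemma isZero_left (h : IsLongExact R₀ R₁ f g) (hY : IsZero (R₀.obj (op Y)))
    (hZ : IsZero (R₁.obj (op Z))) : IsZero (R₀.obj (op X)) := by
  obtain ⟨δ, hδ⟩ := h
  exact (hδ.exact 1).isZero_of_both_zeros (hY.eq_of_src _ _) (hZ.eq_of_tgt _ _)

lemma isZero_right (h : IsLongExact R₀ R₁ f g) (hX : IsZero (R₀.obj (op X)))
    (hY : IsZero (R₁.obj (op Y))) : IsZero (R₁.obj (op Z)) := by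
  obtain ⟨δ, hδ⟩ := h
  exact (hδ.exact 2).isZero_of_both_zeros (hX.eq_of_src _ _) (hY.eq_of_tgt _ _)

end IsLongExact

end LongExact

/-! ### Triangles of complexes under a contravariant functor. -/

section Triangles

variable {A : Type u} [Category.{v} A] [Abelian A] {B : Type u'} [Category.{v'} B] [Abelian B]
  (Φ : Aᵒᵖ ⥤ B) [Φ.Additive]

/-- An additive functor preserves split sequences, so `Φ` yields a short exact sequence of complexes
without any exactness assumption on `Φ`. -/
lemma isLongExact_of_degreewiseSplit (S : ShortComplex (CochainComplex A ℤ))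
    (σ : ∀ n, (S.map (HomologicalComplex.eval A _ n)).Splitting) (i : ℤ) :
    IsLongExact (contraComplex Φ ⋙ HomologicalComplex.homologyFunctor B (.up ℤ) i)
      (contraComplex Φ ⋙ HomologicalComplex.homologyFunctor B (.up ℤ) (i + 1)) S.f S.g := by
  let S' : ShortComplex (CochainComplex B ℤ) :=
    ShortComplex.mk ((contraComplex Φ).map S.g.op) ((contraComplex Φ).map S.f.op) (by
      ext n
      change Φ.map (S.g.f (-n)).op ≫ Φ.map (S.f.f (-n)).op = 0
      rw [← Φ.map_comp, ← op_comp, ← HomologicalComplex.comp_f, S.zero]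
      simp)
  have hS' : S'.ShortExact :=
    HomologicalComplex.shortExact_of_degreewise_shortExact _ (fun n =>
      ((σ (-n)).op.map Φ).shortExact)
  exact ⟨_, HomologicalComplex.HomologySequence.composableArrows₅_exact hS' i (i + 1) rfl⟩

variable [HasDerivedCategory.{w} B]

/-- The cohomology of the complex `Φ(K)`, for `K` in the homotopy category. -/
noncomputable def contraHomology (i : ℤ) : (HomotopyCategory A (.up ℤ))ᵒᵖ ⥤ B :=
  contraHomotopy Φ ⋙ DerivedCategory.Qh ⋙ DerivedCategory.homologyFunctor B i

/-- The functor `contraHomology` is computed by the complexes `Φ(K)`. -/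
noncomputable def quotientContraHomologyIso (i : ℤ) :
    (HomotopyCategory.quotient A (.up ℤ)).op ⋙ contraHomology Φ i ≅
      contraComplex Φ ⋙ HomologicalComplex.homologyFunctor B (.up ℤ) i :=
  Functor.isoWhiskerLeft (contraComplex Φ)
    (Functor.isoWhiskerRight (DerivedCategory.quotientCompQhIso B)
      (DerivedCategory.homologyFunctor B i) ≪≫ DerivedCategory.homologyFunctorFactors B i)

lemma isLongExact_contraHomology (T : Triangle (HomotopyCategory A (.up ℤ)))
    (hT : T ∈ distTriang _) (i : ℤ) :
    IsLongExact (contraHomology Φ i) (contraHomology Φ (i + 1)) T.mor₁ T.mor₂ := by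
  -- Every distinguished triangle comes from a degreewise split sequence, up to isomorphism.
  obtain ⟨S, σ, ⟨e⟩⟩ := (HomotopyCategory.distinguished_iff_iso_trianglehOfDegreewiseSplit T).1 hT
  have h₁ : IsLongExact (contraHomology Φ i) (contraHomology Φ (i + 1))
      ((HomotopyCategory.quotient A (.up ℤ)).map S.f)
      ((HomotopyCategory.quotient A (.up ℤ)).map S.g) := by
    have a (i : ℤ) := (quotientContraHomologyIso Φ i).symm
    exact (isLongExact_of_degreewiseSplit Φ S σ i).of_iso
      ((a i).app _) ((a i).app _) ((a i).app _) ((a _).app _) ((a _).app _) ((a _).app _)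
      ((a i).hom.naturality S.f.op) ((a i).hom.naturality S.g.op)
      ((a _).hom.naturality S.f.op) ((a _).hom.naturality S.g.op)
  have hf : T.mor₁ ≫ e.hom.hom₂ = e.hom.hom₁ ≫ (HomotopyCategory.quotient A (.up ℤ)).map S.f :=
    e.hom.comm₁
  have hg : T.mor₂ ≫ e.hom.hom₃ = e.hom.hom₂ ≫ (HomotopyCategory.quotient A (.up ℤ)).map S.g :=
    e.hom.comm₂
  let e₁ := (Triangle.π₁.mapIso e).op
  let e₂ := (Triangle.π₂.mapIso e).op
  let e₃ := (Triangle.π₃.mapIso e).op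
  have comm (F : (HomotopyCategory A (.up ℤ))ᵒᵖ ⥤ B) :
      F.map ((HomotopyCategory.quotient A (.up ℤ)).map S.f).op ≫ (F.mapIso e₁).hom =
        (F.mapIso e₂).hom ≫ F.map T.mor₁.op :=
    (F.map_comp _ _).symm.trans ((F.congr_map (congrArg Quiver.Hom.op hf.symm)).trans
      (F.map_comp e.hom.hom₂.op T.mor₁.op))
  have comm' (F : (HomotopyCategory A (.up ℤ))ᵒᵖ ⥤ B) :
      F.map ((HomotopyCategory.quotient A (.up ℤ)).map S.g).op ≫ (F.mapIso e₂).hom =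
        (F.mapIso e₃).hom ≫ F.map T.mor₂.op :=
    (F.map_comp _ _).symm.trans ((F.congr_map (congrArg Quiver.Hom.op hg.symm)).trans
      (F.map_comp e.hom.hom₃.op T.mor₂.op))
  exact h₁.of_iso (Functor.mapIso _ e₁) (Functor.mapIso _ e₂) (Functor.mapIso _ e₃)
    (Functor.mapIso _ e₁) (Functor.mapIso _ e₂) (Functor.mapIso _ e₃)
    (comm _) (comm' _) (comm _) (comm' _)

end Triangles

/-! ### Long exact sequences of the derived functor. -/

section Derived

variable {A : Type u} [Category.{v} A] [Abelian A] {B : Type u'} [Category.{v'} B] [Abelian B]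
  {Φ : Aᵒᵖ ⥤ B} [Φ.Additive] {b : Boundedness}

/-- Every distinguished triangle of `K^*(A)` is quasi-isomorphic to a distinguished triangle with
objects in a given adapted subcategory. -/
lemma IsAdapted.exists_triangle {P : ObjectProperty (b.K A)} (hP : IsAdapted Φ b P)
    (T : Triangle (b.K A)) (hT : T ∈ distTriang _) :
    ∃ (T' : Triangle (b.K A)) (_ : T' ∈ distTriang _) (φ : T' ⟶ T),
      (P T'.obj₁ ∧ P T'.obj₂ ∧ P T'.obj₃) ∧
      b.quasiIso A φ.hom₁ ∧ b.quasiIso A φ.hom₂ ∧ b.quasiIso A φ.hom₃ := by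
  have := hP.isTriangulated
  have hres := hP.exists_resolution
  rw [b.quasiIso_eq_trW A] at hres ⊢
  obtain ⟨L₂, s, hL₂, hs⟩ := hres T.obj₂
  -- The Ore condition lifts `T.mor₁` along the resolution of its target; resolving the new source
  -- brings the morphism into `P`, and the third vertex is a cone inside `P`.
  obtain ⟨φ, hφ⟩ := MorphismProperty.HasRightCalculusOfFractions.exists_rightFraction
    (W := (b.acyclic A).trW) (MorphismProperty.LeftFraction.mk T.mor₁ s hs)
  obtain ⟨L₁, t, hL₁, ht⟩ := hres φ.X'
  dsimp at φ hφ
  obtain ⟨L₃, hL₃, g, k, hT'⟩ := P.distinguished_cocone_triangle (t ≫ φ.f) hL₁ hL₂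
  have ht' : (b.acyclic A).trW (t ≫ φ.s) := MorphismProperty.comp_mem _ _ _ ht φ.hs
  have hcomm : (t ≫ φ.f) ≫ s = (t ≫ φ.s) ≫ T.mor₁ := by simp [hφ]
  obtain ⟨c, hc, hc₂, hc₃⟩ := MorphismProperty.compatible_with_triangulation _ _ hT' hT
    (t ≫ φ.s) s ht' hs hcomm
  exact ⟨_, hT', Triangle.homMk _ _ (t ≫ φ.s) s c hcomm hc₂ hc₃,
    ⟨hL₁, hL₂, hL₃⟩, ht', hs, hc⟩

variable [HasDerivedCategory.{w} B]

/-- The cohomology `Hⁱ(R^*Φ K)`, for `K` in `K^*(A)`. -/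
noncomputable def derivedHomology (h : HasAdapted Φ b) (i : ℤ) : (b.K A)ᵒᵖ ⥤ B :=
  (b.quasiIso A).Q.op ⋙ totalDerived h ⋙ DerivedCategory.homologyFunctor B i

/-- The canonical morphism `Hⁱ(Φ K) ⟶ Hⁱ(R^*Φ K)`. -/
noncomputable def derivedHomologyUnit (h : HasAdapted Φ b) (i : ℤ) :
    (b.homotopy A).ι.op ⋙ contraHomology Φ i ⟶ derivedHomology h i :=
  Functor.whiskerRight (totalDerivedUnit h) (DerivedCategory.homologyFunctor B i)

lemma isIso_derivedHomology_map (h : HasAdapted Φ b) (i : ℤ) {K L : b.K A} (f : K ⟶ L)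
    (hf : b.quasiIso A f) : IsIso ((derivedHomology h i).map f.op) := by
  have := Localization.inverts (b.quasiIso A).Q (b.quasiIso A) f hf
  dsimp only [derivedHomology, Functor.comp_map, Functor.op_map, Quiver.Hom.unop_op]
  infer_instance

lemma isIso_derivedHomologyUnit_app (h : HasAdapted Φ b) {P : ObjectProperty (b.K A)}
    (hP : IsAdapted Φ b P) (L : b.K A) (hL : P L) (i : ℤ) :
    IsIso ((derivedHomologyUnit h i).app (op L)) := by
  have := isIso_totalDerivedUnit_app h hP L hL
  exact inferInstanceAs (IsIso ((DerivedCategory.homologyFunctor B i).map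
    ((totalDerivedUnit h).app (op L))))

/-- On a triangle with vertices in `P` the derived cohomology is that of `Φ`, and quasi-isomorphisms
do not change it, so the sequence of a resolved triangle is carried over. -/
lemma isLongExact_derivedHomology (h : HasAdapted Φ b) (T : Triangle (b.K A))
    (hT : T ∈ distTriang _) (i : ℤ) :
    IsLongExact (derivedHomology h i) (derivedHomology h (i + 1)) T.mor₁ T.mor₂ := by
  obtain ⟨P, hP⟩ := id h
  obtain ⟨T', hT', φ, ⟨h₁, h₂, h₃⟩, hφ₁, hφ₂, hφ₃⟩ := hP.exists_triangle T hT
  have hT'' : IsLongExact ((b.homotopy A).ι.op ⋙ contraHomology Φ i)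
      ((b.homotopy A).ι.op ⋙ contraHomology Φ (i + 1)) T'.mor₁ T'.mor₂ :=
    isLongExact_contraHomology Φ _ ((b.homotopy A).ι.map_distinguished T' hT') i
  have hu (i : ℤ) (L : b.K A) (hL : P L) := isIso_derivedHomologyUnit_app h hP L hL i
  have hR (i : ℤ) {K L : b.K A} (f : K ⟶ L) (hf : b.quasiIso A f) :=
    isIso_derivedHomology_map h i f hf
  let a (i : ℤ) {K L : b.K A} (f : K ⟶ L) (hK : P K) (hf : b.quasiIso A f) :
      ((b.homotopy A).ι.op ⋙ contraHomology Φ i).obj (op K) ≅ (derivedHomology h i).obj (op L) :=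
    have := hu i K hK
    have := hR i f hf
    asIso ((derivedHomologyUnit h i).app (op K)) ≪≫ (asIso ((derivedHomology h i).map f.op)).symm
  have ha (i : ℤ) {K L K' L' : b.K A} (f : K ⟶ L) (hK : P K) (hf : b.quasiIso A f)
      (f' : K' ⟶ L') (hK' : P K') (hf' : b.quasiIso A f') (x : K ⟶ K') (y : L ⟶ L')
      (hxy : x ≫ f' = f ≫ y) :
      ((b.homotopy A).ι.op ⋙ contraHomology Φ i).map x.op ≫ (a i f hK hf).hom =
        (a i f' hK' hf').hom ≫ (derivedHomology h i).map y.op := by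
    have := hR i f hf
    have := hR i f' hf'
    have := (derivedHomology h i).congr_map (congrArg Quiver.Hom.op hxy)
    simp only [op_comp, Functor.map_comp] at this
    simp only [a, Iso.trans_hom, asIso_hom, Iso.symm_hom, asIso_inv]
    rw [(derivedHomologyUnit h i).naturality_assoc, assoc]
    congr 1
    rw [IsIso.comp_inv_eq, assoc, ← this, IsIso.inv_hom_id_assoc]
  exact hT''.of_iso (a i _ h₁ hφ₁) (a i _ h₂ hφ₂) (a i _ h₃ hφ₃) (a _ _ h₁ hφ₁) (a _ _ h₂ hφ₂)
    (a _ _ h₃ hφ₃)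
    (ha _ _ h₁ hφ₁ _ h₂ hφ₂ _ _ φ.comm₁) (ha _ _ h₂ hφ₂ _ h₃ hφ₃ _ _ φ.comm₂)
    (ha _ _ h₁ hφ₁ _ h₂ hφ₂ _ _ φ.comm₁) (ha _ _ h₂ hφ₂ _ h₃ hφ₃ _ _ φ.comm₂)

end Derived

end ContravariantDerived

/-! ### Triangles in `K^*(A)` and resolutions of stalk complexes. -/

namespace ContravariantDerived

/-- The inclusion is full and faithful, so the third morphism lifts once corrected by the
isomorphism commuting the inclusion with the shift. -/
lemma exists_distinguished_of_map {T : Type*} [Category* T] [HasZeroObject T] [HasShift T ℤ]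
    [Preadditive T] [∀ n : ℤ, (shiftFunctor T n).Additive] [Pretriangulated T]
    (P : ObjectProperty T) [P.IsTriangulated] {X Y Z : P.FullSubcategory} (f : X ⟶ Y) (g : Y ⟶ Z)
    (δ : Z.obj ⟶ X.obj⟦(1 : ℤ)⟧) (hT : Triangle.mk f.hom g.hom δ ∈ distTriang T) :
    ∃ δ' : Z ⟶ X⟦(1 : ℤ)⟧, Triangle.mk f g δ' ∈ distTriang P.FullSubcategory := by
  let e := P.ι.commShiftIso (1 : ℤ)
  obtain ⟨δ', hδ'⟩ := P.ι.map_surjective (δ ≫ e.inv.app X)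
  refine ⟨δ', isomorphic_distinguished _ hT _
    (Triangle.isoMk _ _ (Iso.refl _) (Iso.refl _) (Iso.refl _)
      ((comp_id _).trans (id_comp _).symm) ((comp_id _).trans (id_comp _).symm) ?_)⟩
  have h : P.ι.map δ' ≫ e.hom.app X = δ := by
    rw [hδ']
    exact (assoc _ _ _).trans ((congrArg (δ ≫ ·) (e.inv_hom_id_app X)).trans (comp_id δ))
  change (P.ι.map δ' ≫ e.hom.app X) ≫ (shiftFunctor T (1 : ℤ)).map (𝟙 X.obj) = 𝟙 Z.obj ≫ δ
  rw [h]
  exact (congrArg (δ ≫ ·) ((shiftFunctor T (1 : ℤ)).map_id X.obj)).trans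
    ((comp_id δ).trans (id_comp δ).symm)

end ContravariantDerived

namespace Boundedness

variable {A : Type u} [Category.{v} A] [Abelian A] (b : Boundedness)

/-- The functor which sends an object to the corresponding complex concentrated in degree `0`. -/
noncomputable def stalkFunctor : A ⥤ b.K A :=
  (b.homotopy A).lift (CochainComplex.singleFunctor A 0 ⋙ HomotopyCategory.quotient A (.up ℤ))
    (fun X => b.cochain_single X 0)

variable {b}

/-- A complex of the given boundedness type, as an object of `K^*(A)`. -/
abbrev mk (K : CochainComplex A ℤ) (hK : b.cochain A K) : b.K A :=
  ⟨(HomotopyCategory.quotient A (.up ℤ)).obj K, hK⟩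

/-- The morphism of `K^*(A)` given by a morphism of complexes. -/
abbrev mkHom {K L : CochainComplex A ℤ} (hK : b.cochain A K) (hL : b.cochain A L) (f : K ⟶ L) :
    mk K hK ⟶ mk L hL :=
  (b.homotopy A).homMk ((HomotopyCategory.quotient A (.up ℤ)).map f)

lemma quasiIso_mkHom_iff {K L : CochainComplex A ℤ} (hK : b.cochain A K) (hL : b.cochain A L)
    (f : K ⟶ L) : b.quasiIso A (mkHom hK hL f) ↔ QuasiIso f :=
  HomotopyCategory.quotient_map_mem_quasiIso_iff f

lemma cochain_truncLE (K : CochainComplex A ℤ) (hK : b.cochain A K) (n : ℤ) :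
    b.cochain A (K.truncLE n) := by
  have h₁ (h : ∃ m : ℤ, K.IsStrictlyGE m) : ∃ m : ℤ, (K.truncLE n).IsStrictlyGE m := by
    obtain ⟨m, _⟩ := h
    exact ⟨m, inferInstance⟩
  have h₂ : ∃ m : ℤ, (K.truncLE n).IsStrictlyLE m := ⟨n, inferInstance⟩
  cases b
  · trivial
  · exact h₁ hK
  · exact h₂
  · exact ⟨h₁ hK.1, h₂⟩

lemma exists_mappingCone_distinguished {K L : CochainComplex A ℤ} (hK : b.cochain A K)
    (hL : b.cochain A L) (f : K ⟶ L) :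
    ∃ δ : mk _ (b.cochain_cone f hK hL) ⟶ (mk K hK)⟦(1 : ℤ)⟧,
      Triangle.mk (mkHom hK hL f) (mkHom hL _ (CochainComplex.mappingCone.inr f)) δ ∈
        distTriang (b.K A) := by
  exact exists_distinguished_of_map (b.homotopy A) (mkHom hK hL f)
    (mkHom hL (b.cochain_cone f hK hL) (CochainComplex.mappingCone.inr f))
    (CochainComplex.mappingCone.triangleh f).mor₃
    (HomotopyCategory.mappingCone_triangleh_distinguished f)

end Boundedness

namespace ContravariantDerived

variable {A : Type u} [Category.{v} A] [Abelian A] {B : Type u'} [Category.{v'} B] [Abelian B]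

section Complexes

variable (Φ : Aᵒᵖ ⥤ B) [Φ.Additive]

lemma isZero_contraComplex_X {K : CochainComplex A ℤ} {i : ℤ} (h : IsZero (K.X (-i))) :
    IsZero (((contraComplex Φ).obj (op K)).X i) :=
  Φ.map_isZero h.op

lemma isZero_homology_contraComplex {K : CochainComplex A ℤ} {i : ℤ} (h : IsZero (K.X (-i))) :
    IsZero (((contraComplex Φ).obj (op K)).homology i) :=
  ShortComplex.isZero_homology_of_isZero_X₂ _ (isZero_contraComplex_X Φ h)

/-- The hypothesis says that `K⁻¹ ⟶ K⁰ ⟶ L⁰ ⟶ 0` is exact; left exactness turns this cokernel into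
the kernel that computes `H⁰(ΦK)`. -/
lemma quasiIsoAt_contraComplex_map [PreservesFiniteLimits Φ] {K L : CochainComplex A ℤ} (f : K ⟶ L)
    [K.IsStrictlyLE 0] [L.IsStrictlyLE 0] [L.IsStrictlyGE 0] [QuasiIsoAt f 0] :
    QuasiIsoAt ((contraComplex Φ).map f.op) 0 := by
  have hL (i : ℤ) (hi : i ≠ 0) : IsZero (L.X i) := by
    obtain hi | hi := hi.lt_or_gt
    · exact L.isZero_of_isStrictlyGE 0 i hi
    · exact L.isZero_of_isStrictlyLE 0 i hi
  have h₁ : QuasiIsoAt f 0 := inferInstance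
  rw [quasiIsoAt_iff' _ (-1) 0 1 (by simp) (by simp), ShortComplex.quasiIso_iff_of_zeros'] at h₁
  · rw [quasiIsoAt_iff' _ (-1) 0 1 (by simp) (by simp), ShortComplex.quasiIso_iff_of_zeros]
    · obtain ⟨h₁, h₂⟩ := h₁
      have : Epi (f.f 0) := h₂
      have h₃ := h₁.op
      have : Mono (ShortComplex.mk (K.d (-1) 0) (f.f 0) (by
        rw [← f.comm, (hL (-1) (by simp)).eq_of_src (L.d (-1) 0) 0, comp_zero])).op.f :=
          op_mono_of_epi (f.f 0)
      have h₄ := h₃.map_of_mono_of_preservesKernel Φ this inferInstance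
      have : Mono (f.f 0).op := op_mono_of_epi (f.f 0)
      exact ⟨h₄, inferInstanceAs (Mono (Φ.map (f.f 0).op))⟩
    · exact (isZero_contraComplex_X Φ (hL _ (by simp))).eq_of_src _ _
    · exact (isZero_contraComplex_X Φ (hL _ (by simp))).eq_of_tgt _ _
    · exact (isZero_contraComplex_X Φ (K.isZero_of_isStrictlyLE 0 _ (by simp))).eq_of_src _ _
  · exact (K.isZero_of_isStrictlyLE 0 _ (by simp)).eq_of_tgt _ _
  · exact (hL _ (by simp)).eq_of_src _ _
  · exact (hL _ (by simp)).eq_of_tgt _ _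

end Complexes

section

variable {Φ : Aᵒᵖ ⥤ B} [Φ.Additive] {b : Boundedness}

/-- A stalk complex has a resolution `L` in any adapted subcategory, with a quasi-isomorphic
subcomplex in nonpositive degrees. -/
lemma IsAdapted.exists_resolution_single {P : ObjectProperty (b.K A)} (hP : IsAdapted Φ b P)
    (X : A) :
    ∃ (L K : CochainComplex A ℤ) (hL : b.cochain A L) (_ : b.cochain A K)
      (p : L ⟶ (CochainComplex.singleFunctor A 0).obj X) (j : K ⟶ L),
      P (Boundedness.mk L hL) ∧ K.IsStrictlyLE 0 ∧ QuasiIso p ∧ QuasiIso j := by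
  obtain ⟨⟨L, hL⟩, p, hPL, hp⟩ := hP.exists_resolution (b.stalk X)
  obtain ⟨L : CochainComplex A ℤ, rfl⟩ := HomotopyCategory.quotient_obj_surjective L
  obtain ⟨p, rfl⟩ := ObjectProperty.homMk_surjective p
  obtain ⟨p, rfl⟩ := (HomotopyCategory.quotient A (.up ℤ)).map_surjective p
  have hp : QuasiIso p := (Boundedness.quasiIso_mkHom_iff _ _ _).1 hp
  -- `L` has the cohomology of a stalk, so its canonical truncation in degrees `≤ 0` is
  -- quasi-isomorphic to it.
  have : L.IsLE 0 := by
    rw [CochainComplex.isLE_iff]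
    intro i hi
    rw [HomologicalComplex.exactAt_iff_isZero_homology]
    refine IsZero.of_iso ?_ (asIso (HomologicalComplex.homologyMap p i))
    exact (((CochainComplex.singleFunctor A 0).obj X).exactAt_of_isLE 0 i hi).isZero_homology
  exact ⟨L, L.truncLE 0, hL, Boundedness.cochain_truncLE L hL 0, p, L.ιTruncLE 0, hPL,
    inferInstance, hp, inferInstance⟩

variable [HasDerivedCategory.{w} B]

/-- The contravariant functors `X ↦ Hⁱ(R^*Φ X)` on `A`. -/
noncomputable def cohomologyFunctor (h : HasAdapted Φ b) (i : ℤ) : Aᵒᵖ ⥤ B :=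
  b.stalkFunctor.op ⋙ derivedHomology h i

/-- Serves to replace the mapping cone of a monomorphism by its cokernel. -/
lemma isLongExact_derivedHomology_of_quasiIso (h : HasAdapted Φ b) {X Y Z C : b.K A} {f : X ⟶ Y}
    {c : Y ⟶ C} {δ : C ⟶ X⟦(1 : ℤ)⟧} (hT : Triangle.mk f c δ ∈ distTriang _) (q : C ⟶ Z)
    (hq : b.quasiIso A q) (i : ℤ) :
    IsLongExact (derivedHomology h i) (derivedHomology h (i + 1)) f (c ≫ q) := by
  have hq' (i : ℤ) := isIso_derivedHomology_map h i q hq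
  have hcq (i : ℤ) : (derivedHomology h i).map c.op ≫ 𝟙 _ =
      (asIso ((derivedHomology h i).map q.op)).inv ≫ (derivedHomology h i).map (c ≫ q).op := by
    rw [asIso_inv, IsIso.eq_inv_comp, comp_id, ← Functor.map_comp, ← op_comp]
  exact (isLongExact_derivedHomology h _ hT i).of_iso (Iso.refl _) (Iso.refl _)
    (asIso ((derivedHomology h i).map q.op)).symm
    (Iso.refl _) (Iso.refl _) (asIso ((derivedHomology h _).map q.op)).symm
    ((comp_id _).trans (id_comp _).symm) (hcq i) ((comp_id _).trans (id_comp _).symm) (hcq _)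

/-- The long exact sequence of `R^*Φ`. -/
lemma isLongExact_cohomologyFunctor (h : HasAdapted Φ b) {S : ShortComplex A} (hS : S.ShortExact)
    (i : ℤ) :
    IsLongExact (cohomologyFunctor h i) (cohomologyFunctor h (i + 1)) S.f S.g := by
  let S' := S.map (CochainComplex.singleFunctor A 0)
  have hS' : S'.ShortExact := hS.map_of_exact (HomologicalComplex.single A (.up ℤ) 0)
  have h₁ : b.cochain A S'.X₁ := b.cochain_single _ 0
  have h₂ : b.cochain A S'.X₂ := b.cochain_single _ 0
  have h₃ : b.cochain A S'.X₃ := b.cochain_single _ 0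
  obtain ⟨δ, hT⟩ := Boundedness.exists_mappingCone_distinguished h₁ h₂ S'.f
  let p := CochainComplex.mappingCone.descShortComplex S'
  have hp : QuasiIso p := CochainComplex.mappingCone.quasiIso_descShortComplex hS'
  have hg : Boundedness.mkHom h₂ (b.cochain_cone S'.f h₁ h₂)
      (CochainComplex.mappingCone.inr S'.f) ≫ Boundedness.mkHom _ h₃ p =
        Boundedness.mkHom h₂ h₃ S'.g := by
    rw [← CochainComplex.mappingCone.inr_descShortComplex S']
    ext
    exact ((HomotopyCategory.quotient A (.up ℤ)).map_comp _ _).symm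
  have := isLongExact_derivedHomology_of_quasiIso h hT (Boundedness.mkHom _ h₃ p)
    ((Boundedness.quasiIso_mkHom_iff _ _ _).2 hp) i
  rw [hg] at this
  exact this

end

end ContravariantDerived

namespace ContravariantDerived

variable {A : Type u} [Category.{v} A] [Abelian A] {B : Type u'} [Category.{v'} B] [Abelian B]

/-! ### Derived cohomology of objects: negative degrees, degree zero, projectives. -/

section Stalks

variable (Φ : Aᵒᵖ ⥤ B) [Φ.Additive]

/-- The homology in degree `0` of complexes concentrated in degree `0`. -/
noncomputable def evalIsoHomology {D : Type*} [Category* D] (G : D ⥤ CochainComplex B ℤ)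
    (h₁ : ∀ X, IsZero ((G.obj X).X (-1))) (h₂ : ∀ X, IsZero ((G.obj X).X 1)) :
    G ⋙ HomologicalComplex.eval B (.up ℤ) 0 ≅
      G ⋙ HomologicalComplex.homologyFunctor B (.up ℤ) 0 :=
  NatIso.ofComponents (fun X =>
    ((G.obj X).iCyclesIso 0 1 (by simp) ((h₂ X).eq_of_tgt _ _)).symm ≪≫
      (G.obj X).isoHomologyπ (-1) 0 (by simp) ((h₁ X).eq_of_src _ _)) (fun {X Y} f => by
      change (G.map f).f 0 ≫
        ((G.obj Y).iCyclesIso 0 1 (by simp) ((h₂ Y).eq_of_tgt _ _)).inv ≫ (G.obj Y).homologyπ 0 =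
        (((G.obj X).iCyclesIso 0 1 (by simp) ((h₂ X).eq_of_tgt _ _)).inv ≫ (G.obj X).homologyπ 0) ≫
          HomologicalComplex.homologyMap (G.map f) 0
      rw [assoc, HomologicalComplex.homologyπ_naturality, ← assoc, ← assoc]
      congr 1
      rw [Iso.eq_inv_comp, ← assoc, Iso.comp_inv_eq, HomologicalComplex.iCyclesIso_hom,
        HomologicalComplex.iCyclesIso_hom, HomologicalComplex.cyclesMap_i])

/-- `Φ X` is the homology in degree `0` of the complex `Φ(X)`. -/
noncomputable def isoHomologySingle :
    Φ ≅ (CochainComplex.singleFunctor A 0).op ⋙ contraComplex Φ ⋙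
      HomologicalComplex.homologyFunctor B (.up ℤ) 0 :=
  (NatIso.ofComponents
    (fun X => Φ.mapIso (HomologicalComplex.singleObjXSelf (.up ℤ) (0 : ℤ) X.unop).op)
    (fun {X Y} f => by
      change Φ.map f ≫ Φ.map (HomologicalComplex.singleObjXSelf (.up ℤ) (0 : ℤ) Y.unop).hom.op =
        Φ.map (HomologicalComplex.singleObjXSelf (.up ℤ) (0 : ℤ) X.unop).hom.op ≫
          Φ.map (((HomologicalComplex.single A (.up ℤ) (0 : ℤ)).map f.unop).f 0).op
      rw [← Φ.map_comp, ← Φ.map_comp, HomologicalComplex.single_map_f_self, ← op_comp]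
      simp) :
    Φ ≅ (CochainComplex.singleFunctor A 0).op ⋙ contraComplex Φ ⋙
      HomologicalComplex.eval B (.up ℤ) 0) ≪≫
    evalIsoHomology ((CochainComplex.singleFunctor A 0).op ⋙ contraComplex Φ)
      (fun X => isZero_contraComplex_X Φ (HomologicalComplex.isZero_single_obj_X _ _ _ _ (by simp)))
      (fun X => isZero_contraComplex_X Φ (HomologicalComplex.isZero_single_obj_X _ _ _ _ (by simp)))

end Stalks

section

variable {Φ : Aᵒᵖ ⥤ B} [Φ.Additive] {b : Boundedness} [HasDerivedCategory.{w} B]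

lemma isIso_contraHomology_map {K L : CochainComplex A ℤ} (f : K ⟶ L) (i : ℤ)
    (hf : QuasiIsoAt ((contraComplex Φ).map f.op) i) :
    IsIso ((contraHomology Φ i).map ((HomotopyCategory.quotient A (.up ℤ)).map f).op) := by
  rw [quasiIsoAt_iff_isIso_homologyMap] at hf
  exact (NatIso.isIso_map_iff (quotientContraHomologyIso Φ i) f.op).2 hf

lemma isZero_contraHomology_obj {K : CochainComplex A ℤ} {i : ℤ} (hK : IsZero (K.X (-i))) :
    IsZero ((contraHomology Φ i).obj (op ((HomotopyCategory.quotient A (.up ℤ)).obj K))) :=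
  (isZero_homology_contraComplex Φ hK).of_iso ((quotientContraHomologyIso Φ i).app (op K))

/-- If `L` belongs to an adapted subcategory, then `Hⁱ(ΦL) ⟶ Hⁱ(ΦK)` is a monomorphism for any
quasi-isomorphism `K ⟶ L`. -/
lemma mono_contraHomology_map (h : HasAdapted Φ b) {P : ObjectProperty (b.K A)}
    (hP : IsAdapted Φ b P) {K L : b.K A} (hL : P L) (q : K ⟶ L) (i : ℤ)
    [IsIso ((derivedHomology h i).map q.op)] :
    Mono (((b.homotopy A).ι.op ⋙ contraHomology Φ i).map q.op) := by
  have := isIso_derivedHomologyUnit_app h hP L hL i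
  -- The path of this square through `L` is an isomorphism, so the first map of the other path is a
  -- monomorphism.
  have := (derivedHomologyUnit h i).naturality q.op
  exact mono_of_mono_fac this

lemma isZero_derivedHomology_obj (h : HasAdapted Φ b) {P : ObjectProperty (b.K A)}
    (hP : IsAdapted Φ b P) {K L : b.K A} (hL : P L) (q : K ⟶ L) (i : ℤ)
    [IsIso ((derivedHomology h i).map q.op)] (hK : IsZero ((contraHomology Φ i).obj (op K.obj))) :
    IsZero ((derivedHomology h i).obj (op L)) := by
  have := isIso_derivedHomologyUnit_app h hP L hL i
  have := mono_contraHomology_map h hP hL q i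
  exact (IsZero.of_mono (((b.homotopy A).ι.op ⋙ contraHomology Φ i).map q.op) hK).of_iso
    (asIso ((derivedHomologyUnit h i).app (op L))).symm

/-- `Hⁱ(RΦ X) ≅ Hⁱ(ΦL)` embeds in `Hⁱ(ΦK)` with `K` in degrees `≤ 0`, and `ΦK` has no terms in
negative degrees. -/
lemma isZero_cohomology_of_neg (h : HasAdapted Φ b) (X : A) (i : ℤ) (hi : i < 0) :
    IsZero (cohomology h X i) := by
  obtain ⟨P, hP⟩ := id h
  obtain ⟨L, K, hL, hK, p, j, hPL, _, hp, hj⟩ := hP.exists_resolution_single X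
  have := isIso_derivedHomology_map h i (Boundedness.mkHom hK hL j)
    ((Boundedness.quasiIso_mkHom_iff _ _ _).2 hj)
  have := isIso_derivedHomology_map h i (Boundedness.mkHom hL (b.cochain_single X 0) p)
    ((Boundedness.quasiIso_mkHom_iff _ _ _).2 hp)
  let e := asIso ((derivedHomology h i).map (Boundedness.mkHom hL (b.cochain_single X 0) p).op)
  exact (isZero_derivedHomology_obj h hP hPL (Boundedness.mkHom hK hL j) i
    (isZero_contraHomology_obj (K.isZero_of_isStrictlyLE 0 _ (by lia)))).of_iso e

lemma isIso_derivedHomologyUnit_app_stalk [PreservesFiniteLimits Φ] (h : HasAdapted Φ b) (X : A) :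
    IsIso ((derivedHomologyUnit h 0).app (op (b.stalk X))) := by
  have hX := b.cochain_single X 0
  change IsIso ((derivedHomologyUnit h 0).app (op (Boundedness.mk _ hX)))
  obtain ⟨P, hP⟩ := id h
  obtain ⟨L, K, hL, hK, p, j, hPL, _, hp, hj⟩ := hP.exists_resolution_single X
  let j' := Boundedness.mkHom hK hL j
  let p' := Boundedness.mkHom hL hX p
  have := isIso_derivedHomology_map h 0 j' ((Boundedness.quasiIso_mkHom_iff _ _ _).2 hj)
  have := isIso_derivedHomology_map h 0 p' ((Boundedness.quasiIso_mkHom_iff _ _ _).2 hp)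
  have := mono_contraHomology_map h hP hPL j' 0
  have := isIso_derivedHomologyUnit_app h hP _ hPL 0
  let H := (b.homotopy A).ι.op ⋙ contraHomology Φ 0
  -- Left exactness makes `H⁰(ΦX) ⟶ H⁰(ΦL) ⟶ H⁰(ΦK)` an isomorphism. The second map is thus epi as
  -- well as mono, so both maps are isomorphisms.
  have hpj : IsIso (H.map (j' ≫ p').op) := by
    have h₁ : QuasiIsoAt ((contraComplex Φ).map (j ≫ p).op) 0 := quasiIsoAt_contraComplex_map Φ _
    have h₂ := isIso_contraHomology_map _ _ h₁
    rwa [Functor.map_comp] at h₂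
  rw [op_comp, H.map_comp] at hpj
  have : Mono (H.map j'.op) := by assumption
  have : Epi (H.map j'.op) := epi_of_epi (H.map p'.op) (H.map j'.op)
  have : IsIso (H.map j'.op) := isIso_of_mono_of_epi _
  have : IsIso (H.map p'.op) := IsIso.of_isIso_comp_right _ (H.map j'.op)
  have hn := (derivedHomologyUnit h 0).naturality p'.op
  have : IsIso ((derivedHomologyUnit h 0).app (op (Boundedness.mk _ hX)) ≫
      (derivedHomology h 0).map p'.op) := by
    have : IsIso (H.map p'.op ≫ (derivedHomologyUnit h 0).app (op (Boundedness.mk L hL))) :=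
      inferInstance
    rwa [← hn]
  exact IsIso.of_isIso_comp_right _ ((derivedHomology h 0).map p'.op)

/-- `H⁰(R^*Φ X)` identifies to `Φ X`. -/
lemma nonempty_iso_cohomologyFunctor_zero [PreservesFiniteLimits Φ] (h : HasAdapted Φ b) :
    Nonempty (Φ ≅ cohomologyFunctor h 0) := by
  let α := Functor.whiskerLeft b.stalkFunctor.op (derivedHomologyUnit h 0)
  have (X : Aᵒᵖ) : IsIso (α.app X) := isIso_derivedHomologyUnit_app_stalk h X.unop
  have hα : IsIso α := NatIso.isIso_of_isIso_app α
  exact ⟨isoHomologySingle Φ ≪≫ Functor.isoWhiskerLeft (CochainComplex.singleFunctor A 0).op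
    (quotientContraHomologyIso Φ 0).symm ≪≫ @asIso _ _ _ _ α hα⟩

/-- Projectivity gives a section `X ⟶ K` of `K ⟶ X`, hence a map `X ⟶ L`. The cohomology of `ΦL`
then embeds in that of the stalk complex `Φ(X)`, which is zero outside degree `0`. -/
lemma isZero_cohomology_of_projective (h : HasAdapted Φ b) (X : A) [Projective X]
    (i : ℤ) (hi : i ≠ 0) : IsZero (cohomology h X i) := by
  obtain ⟨P, hP⟩ := id h
  obtain ⟨L, K, hL, hK, p, j, hPL, _, hp, hj⟩ := hP.exists_resolution_single X
  have hX := b.cochain_single X 0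
  let S : CochainComplex A ℤ := (HomologicalComplex.single A (.up ℤ) 0).obj X
  have hS (i : ℤ) (hi : i ≠ 0) : IsZero (S.X i) := HomologicalComplex.isZero_single_obj_X _ _ _ _ hi
  let f : K ⟶ S := j ≫ p
  have hf : QuasiIsoAt f 0 := inferInstanceAs (QuasiIsoAt (j ≫ p) 0)
  have : Epi (f.f 0) := by
    rw [quasiIsoAt_iff' _ (-1) 0 1 (by simp) (by simp), ShortComplex.quasiIso_iff_of_zeros'] at hf
    · exact hf.2
    · exact (K.isZero_of_isStrictlyLE 0 _ (by simp)).eq_of_tgt _ _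
    · exact (hS (-1) (by simp)).eq_of_src _ _
    · exact (hS 1 (by simp)).eq_of_tgt _ _
  let r := Projective.factorThru (HomologicalComplex.singleObjXSelf (.up ℤ) (0 : ℤ) X).inv (f.f 0)
  let σ : S ⟶ K := HomologicalComplex.mkHomFromSingle r (fun k hk => by
    obtain rfl : 0 + 1 = k := hk
    exact (K.isZero_of_isStrictlyLE 0 _ (by simp)).eq_of_tgt _ _)
  have hσ : σ ≫ f = 𝟙 S := by
    apply HomologicalComplex.from_single_hom_ext
    simp [σ, r]
    rfl
  let p' := Boundedness.mkHom hL hX p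
  let q := Boundedness.mkHom hX hL (σ ≫ j)
  have hqp : q ≫ p' = 𝟙 _ := by
    ext
    refine ((HomotopyCategory.quotient A (.up ℤ)).map_comp (σ ≫ j) p).symm.trans ?_
    have : (σ ≫ j) ≫ p = 𝟙 S := (assoc _ _ _).trans hσ
    rw [this]
    exact (HomotopyCategory.quotient A (.up ℤ)).map_id _
  have := isIso_derivedHomology_map h i p' ((Boundedness.quasiIso_mkHom_iff _ _ _).2 hp)
  have hqp' : (derivedHomology h i).map p'.op ≫ (derivedHomology h i).map q.op = 𝟙 _ := by
    rw [← Functor.map_comp, ← op_comp, hqp]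
    exact (derivedHomology h i).map_id _
  have : IsIso ((derivedHomology h i).map q.op) := by
    have : IsIso ((derivedHomology h i).map p'.op ≫ (derivedHomology h i).map q.op) := by
      rw [hqp']; infer_instance
    exact IsIso.of_isIso_comp_left ((derivedHomology h i).map p'.op) _
  let e := asIso ((derivedHomology h i).map p'.op)
  exact (isZero_derivedHomology_obj h hP hPL q i
    (isZero_contraHomology_obj (hS _ (by lia)))).of_iso e

lemma isZero_cohomology_of_isZero [PreservesFiniteLimits Φ] (h : HasAdapted Φ b) {X : A}
    (hX : IsZero X) (i : ℤ) : IsZero (cohomology h X i) := by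
  by_cases hi : i = 0
  · subst hi
    obtain ⟨e⟩ := nonempty_iso_cohomologyFunctor_zero h
    exact (Φ.map_isZero hX.op).of_iso (e.app (op X)).symm
  · have : Projective X := Projective.of_iso hX.isoZero.symm inferInstance
    exact isZero_cohomology_of_projective h X i hi

end

end ContravariantDerived

namespace ContravariantDerived

/-! ### Exactness lemmas, syzygies and splicing of resolutions. -/

section ShortComplexes

variable {C : Type*} [Category* C] [Abelian C]

lemma exact_comp_mono_iff {X Y Z W : C} (f : X ⟶ Y) (g : Y ⟶ Z) (i : Z ⟶ W) [Mono i]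
    (w : f ≫ g = 0) (w' : f ≫ g ≫ i = 0) :
    (ShortComplex.mk f g w).Exact ↔ (ShortComplex.mk f (g ≫ i) w').Exact := by
  let φ : ShortComplex.mk f g w ⟶ ShortComplex.mk f (g ≫ i) w' := { τ₁ := 𝟙 _, τ₂ := 𝟙 _, τ₃ := i }
  have : Epi φ.τ₁ := inferInstanceAs (Epi (𝟙 _))
  have : IsIso φ.τ₂ := inferInstanceAs (IsIso (𝟙 _))
  have : Mono φ.τ₃ := inferInstanceAs (Mono i)
  exact ShortComplex.exact_iff_of_epi_of_isIso_of_mono φ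

lemma exact_epi_comp_iff {W X Y Z : C} (p : W ⟶ X) [Epi p] (f : X ⟶ Y) (g : Y ⟶ Z)
    (w : f ≫ g = 0) (w' : (p ≫ f) ≫ g = 0) :
    (ShortComplex.mk (p ≫ f) g w').Exact ↔ (ShortComplex.mk f g w).Exact := by
  let φ : ShortComplex.mk (p ≫ f) g w' ⟶ ShortComplex.mk f g w := { τ₁ := p, τ₂ := 𝟙 _, τ₃ := 𝟙 _ }
  have : Epi φ.τ₁ := inferInstanceAs (Epi p)
  have : IsIso φ.τ₂ := inferInstanceAs (IsIso (𝟙 _))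
  have : Mono φ.τ₃ := inferInstanceAs (Mono (𝟙 _))
  exact ShortComplex.exact_iff_of_epi_of_isIso_of_mono φ

lemma isIso₃_of_shortExact_of_isIso₁₂ {S₁ S₂ : ShortComplex C} (φ : S₁ ⟶ S₂)
    (h₁ : S₁.ShortExact) (h₂ : S₂.ShortExact) [IsIso φ.τ₁] [IsIso φ.τ₂] : IsIso φ.τ₃ := by
  have := h₁.epi_g
  have := h₂.epi_g
  have w : S₂.f ≫ inv φ.τ₂ ≫ S₁.g = 0 := by
    rw [← cancel_epi φ.τ₁, φ.comm₁₂_assoc, IsIso.hom_inv_id_assoc, S₁.zero, comp_zero]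
  refine ⟨h₂.exact.desc (inv φ.τ₂ ≫ S₁.g) w, ?_, ?_⟩
  · rw [← cancel_epi S₁.g, ← φ.comm₂₃_assoc, h₂.exact.g_desc, IsIso.hom_inv_id_assoc, comp_id]
  · rw [← cancel_epi S₂.g, h₂.exact.g_desc_assoc, assoc, ← φ.comm₂₃, IsIso.inv_hom_id_assoc,
      comp_id]

end ShortComplexes

section Dimension

variable {A : Type u} [Category.{v} A] [Abelian A] {F : ObjectProperty A}

/-- The first syzygy of a left resolution. -/
lemma HasLeftDimLE.exists_shortExact {M : A} {α : ℕ∞} (h : HasLeftDimLE F M α) :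
    ∃ (N X : A) (i : N ⟶ X) (p : X ⟶ M) (w : i ≫ p = 0), (ShortComplex.mk i p w).ShortExact ∧
      (F X ∨ IsZero X) ∧ (∀ β : ℕ∞, α ≤ β + 1 → HasLeftDimLE F N β) ∧ (α = 0 → IsZero N) := by
  obtain ⟨K, ε, w, hε, hK₀, hK, hF, hα⟩ := h
  let N := kernel ε
  let q : K.X 1 ⟶ N := kernel.lift ε (K.d 1 0) w
  have hq : q ≫ kernel.ι ε = K.d 1 0 := kernel.lift_ι _ _ _
  have hqe : Epi q := hK₀.epi_kernelLift
  refine ⟨N, K.X 0, kernel.ι ε, ε, kernel.condition ε,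
    { exact := ShortComplex.exact_kernel ε }, hF 0, fun β hβ => ?_, fun h0 => ?_⟩
  -- The shifted resolution covers the syzygy; the condition `α ≤ β + 1` stands in for `β = α - 1`,
  -- which would lose the case `α = 0`.
  · have hw : K.d 2 1 ≫ q = 0 := by
      rw [← cancel_mono (kernel.ι ε), assoc, hq, K.d_comp_d, zero_comp]
    refine ⟨ChainComplex.truncate.obj K, q, hw, hqe, ?_, fun n => ?_, fun i => hF _, fun i hi => ?_⟩
    · have h₁ : (ShortComplex.mk (K.d 2 1) (K.d 1 0) (K.d_comp_d _ _ _)).Exact :=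
        (K.exactAt_iff' 2 1 0 (by simp) (by simp)).1 (hK 0)
      refine (exact_comp_mono_iff _ q (kernel.ι ε) hw (by rw [hq, K.d_comp_d])).2 ?_
      simpa only [hq] using h₁
    · have h₁ := (K.exactAt_iff' (n + 3) (n + 2) (n + 1) (by simp) (by simp)).1 (hK (n + 1))
      exact (HomologicalComplex.exactAt_iff' _ (n + 2) (n + 1) n (by simp) (by simp)).2 h₁
    · refine hα (i + 1) (hβ.trans_lt ?_)
      push_cast
      exact (ENat.add_lt_add_iff_right ENat.one_ne_top).2 hi
  · have : IsZero (K.X 1) := hα 1 (by simp [h0])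
    exact IsZero.of_epi q this

/-- Splicing a left resolution. -/
lemma HasLeftDimLE.of_shortExact {S : ShortComplex A} (hS : S.ShortExact)
    (hX : F S.X₂ ∨ IsZero S.X₂) {α : ℕ∞} (h : HasLeftDimLE F S.X₁ α) :
    HasLeftDimLE F S.X₃ (α + 1) := by
  obtain ⟨K, ε, w, hε, hK₀, hK, hF, hα⟩ := h
  have := hS.mono_f
  have w' : K.d 1 0 ≫ ε ≫ S.f = 0 := by rw [reassoc_of% w, zero_comp]
  refine ⟨ChainComplex.augment K (ε ≫ S.f) w', S.g,
    show (ε ≫ S.f) ≫ S.g = 0 by rw [assoc, S.zero, comp_zero], hS.epi_g, ?_, fun n => ?_,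
    fun i => ?_, fun i hi => ?_⟩
  · exact (exact_epi_comp_iff ε S.f S.g S.zero (by simp)).2 hS.exact
  · cases n with
    | zero =>
      refine (HomologicalComplex.exactAt_iff' _ 2 1 0 (by simp) (by simp)).2 ?_
      exact (exact_comp_mono_iff (K.d 1 0) ε S.f w w').1 hK₀
    | succ n =>
      have h₁ := (K.exactAt_iff' (n + 2) (n + 1) n (by simp) (by simp)).1 (hK n)
      exact (HomologicalComplex.exactAt_iff' _ (n + 3) (n + 2) (n + 1) (by simp) (by simp)).2 h₁
  · cases i with
    | zero => exact hX
    | succ i => exact hF i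
  · cases i with
    | zero => simp at hi
    | succ i => exact hα i (by
      push_cast at hi
      exact (ENat.add_lt_add_iff_right ENat.one_ne_top).1 hi)

lemma HasLeftDimLE.of_prop {M : A} (hM : F M ∨ IsZero M) : HasLeftDimLE F M 0 := by
  let K : ChainComplex A ℕ := (ChainComplex.single₀ A).obj M
  have hK (i : ℕ) : IsZero (K.X (i + 1)) := HomologicalComplex.isZero_single_obj_X _ _ _ _ (by simp)
  have hd : K.d 1 0 = 0 := (hK 0).eq_of_src _ _
  let ε : K.X 0 ⟶ M := 𝟙 M
  have : IsIso ε := inferInstanceAs (IsIso (𝟙 M))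
  have w : K.d 1 0 ≫ ε = 0 := by rw [hd, zero_comp]
  refine ⟨K, ε, w, inferInstance, (ShortComplex.exact_iff_mono (ShortComplex.mk _ ε w) hd).2
    (inferInstanceAs (Mono ε)), fun n => ?_,
    fun i => ?_, fun i hi => ?_⟩
  · exact ShortComplex.exact_of_isZero_X₂ _ (hK n)
  · cases i with
    | zero => exact hM
    | succ i => exact Or.inr (hK i)
  · cases i with
    | zero => simp at hi
    | succ i => exact hK i

lemma hasLeftDimLE_leftDim {M : A} {α : ℕ∞} (h : HasLeftDimLE F M α) :
    HasLeftDimLE F M (leftDim F M) :=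
  csInf_mem (s := {α : ℕ∞ | HasLeftDimLE F M α}) ⟨α, h⟩

lemma leftDim_le {M : A} {α : ℕ∞} (h : HasLeftDimLE F M α) : leftDim F M ≤ α :=
  sInf_le h

end Dimension

/-! ### Dimension shifting. -/

section

variable {A : Type u} [Category.{v} A] [Abelian A] {B : Type u'} [Category.{v'} B] [Abelian B]
  [HasDerivedCategory.{w} B] {Φ : Aᵒᵖ ⥤ B} [Φ.Additive] {b : Boundedness}

/-- `H¹(RΦ)` of the quotient is the obstruction to right exactness of `Φ` on the sequence, since
`H⁰(RΦ) ≅ Φ`. -/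
lemma epi_map_of_isZero_cohomology [PreservesFiniteLimits Φ] (h : HasAdapted Φ b)
    {S : ShortComplex A} (hS : S.ShortExact) (h₃ : IsZero (cohomology h S.X₃ 1)) :
    Epi (Φ.map S.f.op) := by
  obtain ⟨e⟩ := nonempty_iso_cohomologyFunctor_zero h
  have := (isLongExact_cohomologyFunctor h hS 0).epi h₃
  exact ((MorphismProperty.epimorphisms B).arrow_mk_iso_iff
    (Arrow.isoMk (e.app _) (e.app _) (e.hom.naturality S.f.op).symm)).2 this

lemma shortExact_map_of_isZero_cohomology [PreservesFiniteLimits Φ] (h : HasAdapted Φ b)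
    {S : ShortComplex A} (hS : S.ShortExact) (h₃ : IsZero (cohomology h S.X₃ 1)) :
    (S.op.map Φ).ShortExact := by
  have := hS.op.mono_f
  exact { exact := hS.op.exact.map_of_mono_of_preservesKernel Φ this inferInstance
          mono_f := inferInstanceAs (Mono (Φ.map S.op.f))
          epi_g := epi_map_of_isZero_cohomology h hS h₃ }

variable (h : HasAdapted Φ b)

lemma isZero_cohomology_X₁ {S : ShortComplex A} (hS : S.ShortExact) (i : ℤ)
    (h₂ : IsZero (cohomology h S.X₂ i)) (h₃ : IsZero (cohomology h S.X₃ (i + 1))) :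
    IsZero (cohomology h S.X₁ i) :=
  (isLongExact_cohomologyFunctor h hS i).isZero_left h₂ h₃

lemma isZero_cohomology_X₃ {S : ShortComplex A} (hS : S.ShortExact) (i : ℤ)
    (h₁ : IsZero (cohomology h S.X₁ i)) (h₂ : IsZero (cohomology h S.X₂ (i + 1))) :
    IsZero (cohomology h S.X₃ (i + 1)) :=
  (isLongExact_cohomologyFunctor h hS i).isZero_right h₁ h₂

variable [PreservesFiniteLimits Φ]

/-- The cohomology of `R^*Φ` vanishes above the dimension relative to a class of acyclic objects. -/
lemma HasLeftDimLE.isZero_cohomology {F : ObjectProperty A} (hF : ∀ X, F X → IsAcyclicFor h X)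
    (n : ℕ) {X : A} (hX : HasLeftDimLE F X n) (i : ℤ) (hi : n < i) :
    IsZero (cohomology h X i) := by
  induction n generalizing X i with
  | zero =>
    obtain ⟨N, Y, a, p, _, hS, hY, -, hN⟩ := hX.exists_shortExact
    have h₁ := isZero_cohomology_of_isZero h (hN rfl) (i - 1)
    have h₂ : IsZero (cohomology h Y (i - 1 + 1)) :=
      hY.elim (fun hY => hF Y hY _ (by lia)) (fun hY => isZero_cohomology_of_isZero h hY _)
    have := isZero_cohomology_X₃ h hS (i - 1) h₁ h₂
    rwa [sub_add_cancel] at this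
  | succ n hn =>
    obtain ⟨N, Y, a, p, _, hS, hY, hN, -⟩ := hX.exists_shortExact
    have h₁ := hn (hN n (by simp)) (i - 1) (by lia)
    have h₂ : IsZero (cohomology h Y (i - 1 + 1)) :=
      hY.elim (fun hY => hF Y hY _ (by lia)) (fun hY => isZero_cohomology_of_isZero h hY _)
    have := isZero_cohomology_X₃ h hS (i - 1) h₁ h₂
    rwa [sub_add_cancel] at this

end

/-- `Φ.rightOp` preserves colimits as a left adjoint, so `Φ` turns them into limits; `Ψ` preserves
limits as a right adjoint. -/
lemma preservesFiniteLimits_of_adjunction {A : Type u} [Category.{v} A] {B : Type u'}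
    [Category.{v'} B] {Φ : Aᵒᵖ ⥤ B} {Ψ : Bᵒᵖ ⥤ A} (adj : Φ.rightOp ⊣ Ψ) :
    PreservesFiniteLimits Φ ∧ PreservesFiniteLimits Ψ := by
  have := adj.leftAdjoint_preservesColimits.{0, 0}
  have := adj.rightAdjoint_preservesLimits.{0, 0}
  exact ⟨preservesFiniteLimits_of_rightOp Φ, inferInstance⟩

/-! ### Closure properties of `𝒢` and the dimension bound. -/

section Gorenstein

variable {A : Type u} [Category.{v} A] [Abelian A] {B : Type u'} [Category.{v'} B] [Abelian B]
  [HasDerivedCategory.{w} A] [HasDerivedCategory.{w'} B]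
  {Φ : Aᵒᵖ ⥤ B} {Ψ : Bᵒᵖ ⥤ A} [Φ.Additive] [Ψ.Additive] (adj : Φ.rightOp ⊣ Ψ)
  {s t : Boundedness} (hΦ : HasAdapted Φ s) (hΨ : HasAdapted Ψ t)

lemma gorensteinClass_of_isZero {X : A} (hX : IsZero X) : gorensteinClass adj hΦ hΨ X := by
  obtain ⟨_, _⟩ := preservesFiniteLimits_of_adjunction adj
  have hΦX : IsZero (Φ.obj (op X)) := Φ.map_isZero hX.op
  refine ⟨fun i _ => isZero_cohomology_of_isZero hΦ hX i,
    fun i _ => isZero_cohomology_of_isZero hΨ hΦX i, ?_⟩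
  exact isIso_of_source_target_iso_zero _ hX.isoZero (Ψ.map_isZero hΦX.op).isoZero

/-- The class `𝒢` is closed under acyclic quotients of objects of `𝒢` by objects of `𝒢`. -/
lemma gorensteinClass_X₃ {S : ShortComplex A} (hS : S.ShortExact)
    (h₁ : gorensteinClass adj hΦ hΨ S.X₁) (h₂ : gorensteinClass adj hΦ hΨ S.X₂)
    (h₃ : IsAcyclicFor hΦ S.X₃) : gorensteinClass adj hΦ hΨ S.X₃ := by
  obtain ⟨_, _⟩ := preservesFiniteLimits_of_adjunction adj
  obtain ⟨-, hΨ₁, hη₁⟩ := h₁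
  obtain ⟨-, hΨ₂, hη₂⟩ := h₂
  -- Acyclicity of the quotient keeps the sequence exact under `Φ`; its new right-hand term is `Φ
  -- X₁`, whose acyclicity keeps it exact under `Ψ`.
  have hS' := shortExact_map_of_isZero_cohomology hΦ hS (h₃ 1 (by simp))
  have hS'' := shortExact_map_of_isZero_cohomology hΨ hS' (hΨ₁ 1 (by simp))
  refine ⟨h₃, fun i hi => ?_, ?_⟩
  · by_cases hi' : i < 0
    · exact isZero_cohomology_of_neg hΨ _ i hi'
    -- Negative degrees are split off because at `i = -1` the shift would land in degree `0`, where
    -- acyclicity says nothing.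
    · exact isZero_cohomology_X₁ hΨ hS' i (hΨ₂ i hi) (hΨ₁ (i + 1) (by lia))
  · let φ : S ⟶ (S.op.map Φ).op.map Ψ :=
      { τ₁ := adj.unit.app _
        τ₂ := adj.unit.app _
        τ₃ := adj.unit.app _
        comm₁₂ := (adj.unit.naturality S.f).symm
        comm₂₃ := (adj.unit.naturality S.g).symm }
    have : IsIso φ.τ₁ := hη₁
    have : IsIso φ.τ₂ := hη₂
    exact isIso₃_of_shortExact_of_isIso₁₂ φ hS hS''

/-- The first syzygy of a Φ-acyclic object is again Φ-acyclic and has a shorter resolution; by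
induction it lies in `𝒢`, and then so does the quotient. -/
lemma gorensteinClass_of_hasLeftDimLE (m : ℕ) {X : A}
    (hX : HasLeftDimLE (gorensteinClass adj hΦ hΨ) X m) (hX' : IsAcyclicFor hΦ X) :
    gorensteinClass adj hΦ hΨ X := by
  obtain ⟨_, _⟩ := preservesFiniteLimits_of_adjunction adj
  induction m generalizing X with
  | zero =>
    obtain ⟨N, Y, a, p, _, hS, hY, -, hN⟩ := hX.exists_shortExact
    exact gorensteinClass_X₃ adj hΦ hΨ hS (gorensteinClass_of_isZero adj hΦ hΨ (hN rfl))
      (hY.elim id (gorensteinClass_of_isZero adj hΦ hΨ)) hX'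
  | succ m hm =>
    obtain ⟨N, Y, a, p, _, hS, hY, hN, -⟩ := hX.exists_shortExact
    have hY := hY.elim id (gorensteinClass_of_isZero adj hΦ hΨ)
    refine gorensteinClass_X₃ adj hΦ hΨ hS (hm (hN m (by simp)) (fun i hi => ?_)) hY hX'
    by_cases hi' : i < 0
    · exact isZero_cohomology_of_neg hΦ _ i hi'
    · exact isZero_cohomology_X₁ hΦ hS i (hY.1 i hi) (hX' (i + 1) (by lia))

/-- For objects of finite `𝒢`-dimension, the `𝒢`-dimension is bounded by the vanishing of the
cohomology of `R^*Φ`. -/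
lemma hasLeftDimLE_of_isZero_cohomology (m : ℕ) {X : A}
    (hX : HasLeftDimLE (gorensteinClass adj hΦ hΨ) X m) (n : ℕ)
    (hn : ∀ i : ℤ, n < i → IsZero (cohomology hΦ X i)) :
    HasLeftDimLE (gorensteinClass adj hΦ hΨ) X n := by
  obtain ⟨_, _⟩ := preservesFiniteLimits_of_adjunction adj
  induction n generalizing X with
  | zero =>
    refine .of_prop (Or.inl (gorensteinClass_of_hasLeftDimLE adj hΦ hΨ m hX (fun i hi => ?_)))
    by_cases hi' : i < 0
    · exact isZero_cohomology_of_neg hΦ _ i hi'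
    · exact hn i (by simp; lia)
  | succ n h =>
    obtain ⟨N, Y, a, p, _, hS, hY, hN, -⟩ := hX.exists_shortExact
    have hY := hY.elim id (gorensteinClass_of_isZero adj hΦ hΨ)
    -- Only `n` drops in this induction; the finite bound `m` is kept for the syzygy, and its
    -- cohomology is that of `X` shifted by one.
    have := h (hN m (by simp)) (fun i hi =>
      isZero_cohomology_X₁ hΦ hS i (hY.1 i (by lia)) (hn (i + 1) (by push_cast; lia)))
    exact_mod_cast HasLeftDimLE.of_shortExact hS (Or.inl hY) this

end Gorenstein

end ContravariantDerived

/-! ### The dimension formula and the comparison with projective dimension. -/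

theorem mainTheorem6 {A : Type u} [Category.{v} A] [Abelian A]
    {B : Type u'} [Category.{v'} B] [Abelian B]
    [HasDerivedCategory.{w} A] [HasDerivedCategory.{w'} B]
    (Φ : Aᵒᵖ ⥤ B) (Ψ : Bᵒᵖ ⥤ A) [Φ.Additive] [Ψ.Additive] (adj : Φ.rightOp ⊣ Ψ)
    (s t : Boundedness) (hΦ : HasAdapted Φ s) (hΨ : HasAdapted Ψ t)
    (X : A) (hX : ∃ m : ℕ, HasLeftDimLE (gorensteinClass adj hΦ hΨ) X (m : ℕ∞)) :
    (¬ IsZero X → ∃ n : ℕ, leftDim (gorensteinClass adj hΦ hΨ) X = (n : ℕ∞) ∧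
      IsLUB {i : ℤ | ¬ IsZero (cohomology hΦ X i)} (n : ℤ)) ∧
    (IsZero X → leftDim (gorensteinClass adj hΦ hΨ) X = 0 ∧
      ∀ i : ℤ, IsZero (cohomology hΦ X i)) ∧
    (EnoughProjectives A →
      leftDim (gorensteinClass adj hΦ hΨ) X ≤ projDim A X) := by
  obtain ⟨_, _⟩ := preservesFiniteLimits_of_adjunction adj
  obtain ⟨m, hm⟩ := hX
  refine ⟨fun hX => ?_, fun hX => ⟨?_, isZero_cohomology_of_isZero hΦ hX⟩, fun _ => ?_⟩
  · obtain ⟨n, hn⟩ : ∃ n : ℕ, leftDim (gorensteinClass adj hΦ hΨ) X = n :=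
      ENat.ne_top_iff_exists.1 (ne_top_of_le_ne_top (ENat.natCast_ne_top m) (leftDim_le hm))
        |>.imp fun _ h => h.symm
    have hXn := hasLeftDimLE_leftDim hm
    rw [hn] at hXn
    refine ⟨n, hn, fun i hi => ?_, fun j hj => ?_⟩
    · by_contra! hni
      exact hi (hXn.isZero_cohomology hΦ (fun _ h => h.1) n i hni)
    · by_contra! hjn
      have hvan (i : ℤ) (hi : j < i) : IsZero (cohomology hΦ X i) := by
        by_contra hi'
        exact absurd (hj hi') (by lia)
      -- An upper bound `j < n` would make the cohomology vanish from degree `n` on. For `n = 0`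
      -- this includes `Φ X`, so `X ≅ ΨΦX` is zero; otherwise it lowers the dimension below its
      -- minimum.
      cases n with
      | zero =>
        have hG := gorensteinClass_of_hasLeftDimLE adj hΦ hΨ m hm (fun i hi => by
          by_cases hi' : i < 0
          · exact isZero_cohomology_of_neg hΦ _ i hi'
          · exact hvan i (by simp at hjn; lia))
        obtain ⟨e⟩ := nonempty_iso_cohomologyFunctor_zero hΦ
        have h₀ : IsZero (Φ.obj (op X)) := (hvan 0 (by simpa using hjn)).of_iso (e.app (op X))
        have := hG.2.2
        exact hX ((Ψ.map_isZero h₀.op).of_iso (asIso (adj.unit.app X)))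
      | succ n =>
        have h₁ := leftDim_le (hasLeftDimLE_of_isZero_cohomology adj hΦ hΨ m hm n
          (fun i hi => hvan i (by push_cast at hjn; lia)))
        rw [hn] at h₁
        norm_cast at h₁
        lia
  · exact le_antisymm (leftDim_le (.of_prop (Or.inr hX))) zero_le
  -- Each finite length of a projective resolution bounds the degrees of nonzero cohomology, hence
  -- the `𝒢`-dimension.
  · refine le_sInf (fun α hα => ?_)
    cases α with
    | top => exact le_top
    | coe n =>
      exact leftDim_le (hasLeftDimLE_of_isZero_cohomology adj hΦ hΨ m hm n
        (HasLeftDimLE.isZero_cohomology hΦ (fun Y hY i hi =>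
          have : Projective Y := hY
          isZero_cohomology_of_projective hΦ Y i hi) n hα))
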